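/- Let $\Omega\subset\mathbb{R}^d$ be a (Lebesgue measurable) set of positive and finite measure, and let $1<p<\infty$. An unconditional Schauder frame of a Banach space $X$ is a sequence $\{(u_n,u_n^*)\}_{n\ge 0}\subset X\times X^*$ such that for every $x\in X$ the series $\sum_n u_n^*(x)\,u_n$, as well as every rearrangement of it, converges to $x$ in norm. Then: (1) In $L^p(\Omega)$, with real scalars and also with complex scalars, there exists an unconditional Schauder frame $\{(g_n,g_n^*)\}$ such that every $g_n$ is $\{-1,+1\}$-valued, that is, $g_n(x)\in\{-1,+1\}$ for a.e. $x\in\Omega$. (2) In the complex space $L^p(\Omega)$ there exists an unconditional Schauder frame $\{(g_n,g_n^*)\}$ such that every $g_n$ is smooth and unimodular, that is, $g_n$ coincides a.e. on $\Omega$ with the restriction of a $C^\infty$ function $\varphi_n:\mathbb{R}^d\to\mathbb{C}$ satisfying $|\varphi_n(x)|=1$ for all $x\in\mathbb{R}^d$. In particular, in both cases $|g_n(x)|=1$ for a.e. $x \in \Omega$, and the sequence $\{g_n\}$ is seminormalized (there are constants $A,B>0$ with $A\le\|g_n\|_{L^p(\Omega)}\le B$ for all $n$) and uniformly bounded (there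 is a constant $M$ with $|g_n(x)|\le M$ for a.e. $x \in \Omega$ and all $n$). -/

import Mathlib

open MeasureTheory Filter Topology
open scoped ENNReal ContDiff

/-- A Schauder frame (quasibasis) of a normed space `X`: vectors `u n` and continuous functionals
`u' n` such that `x = ∑_{n = 0}^∞ u' n x • u n` for every `x`, as the norm limit of the partial
sums. -/
def IsSchauderFrame (𝕜 : Type*) [RCLike 𝕜] {X : Type*} [NormedAddCommGroup X] [NormedSpace 𝕜 X]
    (u : ℕ → X) (u' : ℕ → StrongDual 𝕜 X) : Prop :=
  ∀ x : X, Tendsto (fun N : ℕ => ∑ n ∈ Finset.range N, u' n x • u n) atTop (𝓝 x)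

/-- A Schauder frame is unconditional if, for every `x`, each rearrangement of the series
`∑ u' n x • u n` converges as well (necessarily to `x`, so the limit is written in). -/
def IsUnconditionalSchauderFrame (𝕜 : Type*) [RCLike 𝕜] {X : Type*} [NormedAddCommGroup X]
    [NormedSpace 𝕜 X] (u : ℕ → X) (u' : ℕ → StrongDual 𝕜 X) : Prop :=
  IsSchauderFrame 𝕜 u u' ∧
    ∀ (x : X) (σ : Equiv.Perm ℕ),
      Tendsto (fun N : ℕ => ∑ n ∈ Finset.range N, u' (σ n) x • u (σ n)) atTop (𝓝 x)

/-- The norms `‖u n‖` lie between two positive constants. -/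
def IsSeminormalized {X : Type*} [NormedAddCommGroup X] (u : ℕ → X) : Prop :=
  ∃ A B : ℝ, 0 < A ∧ 0 < B ∧ ∀ n, A ≤ ‖u n‖ ∧ ‖u n‖ ≤ B

/-- There is one constant `M` with `|g n| ≤ M` almost everywhere, for every `n`. -/
def IsUniformlyBounded {α 𝕜 : Type*} [MeasurableSpace α] [RCLike 𝕜] {μ : Measure α} {p : ℝ≥0∞}
    (g : ℕ → Lp 𝕜 p μ) : Prop :=
  ∃ M : ℝ, ∀ n, ∀ᵐ x ∂μ, ‖g n x‖ ≤ M

/-! The plan is to take an unconditional frame of the real space L^p made of bounded functions and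
to replace each vector by many unimodular functions whose average is close to it.

The initial frame is a Haar system. A countable measure-dense family `S n` cuts the space into a
binary tree of cells, and a partial Haar sum over any finite set of cells is a martingale transform
with multipliers 0 and 1. Its L^p bound comes from a Burkholder function U: it dominates c|y|^p -
C|x|^p, is nonpositive for |y| ≤ |x|, and is concave along segments of slope at most one, which is
how the pair (average of f, value of the transform) moves when a cell is split. Given the bound,
convergence need only be checked on multiples of indicators of the `S n`, whose expansions are
finite (`exists_haar_frame`).

Let u be a frame vector with |u| ≤ 1 and let g_1, ..., g_N be unimodular with g_j - u almost
orthogonal in L^2. For large N the sums N⁻¹ ∑_{j ∈ J} (g_j - u) are small in L^2, hence in L^p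
because they are bounded, uniformly over J. Replacing each term u'(x) u by the N terms N⁻¹ u'(x) g_j
then keeps unconditional convergence and turns the reconstruction operator 1 into 1 + R with ‖R‖ <
1; composing the functionals with its inverse restores a frame (`exists_frame_of_splitting`).

It remains to find, given finitely many g, a new y with y - u almost orthogonal to every g - u. For
signs, y is given conditional mean u on each joint level set of u and the g, and orthogonality is
exact. For smooth functions, u is first halved and smoothed, and y = (z + u) / (1 + u z) with z a
plane wave: y - u is a power series in z without constant term, so it tends weakly to 0 as the
frequency grows, by Riemann–Lebesgue. Complex signs come from complexifying the real frame. -/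

/-! ### Burkholder functions. -/

/-- Concavity along all segments of slope at most one. -/
def ZigzagConcave (u : ℝ → ℝ → ℝ) : Prop :=
  ∀ x y h₁ h₂ α β θ : ℝ, 0 ≤ α → 0 ≤ β → α + β = 1 → α * h₁ + β * h₂ = 0 → |θ| ≤ 1 →
    α * u (x + h₁) (y + θ * h₁) + β * u (x + h₂) (y + θ * h₂) ≤ u x y

/-- A segment of slope at most one through (x, y) stays in the cone |y' - y| ≤ |x' - x|, and
averaging the affine bound cancels its linear part. Concavity thus becomes an inequality based at
one point. -/
lemma ZigzagConcave.of_supergradient {u : ℝ → ℝ → ℝ}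
    (H : ∀ x y, ∃ a b, ∀ x' y', |y' - y| ≤ |x' - x| →
      u x' y' ≤ u x y + a * (x' - x) + b * (y' - y)) : ZigzagConcave u := by
  intro x y h₁ h₂ α β θ hα hβ hαβ h0 hθ
  obtain ⟨a, b, hab⟩ := H x y
  have key : ∀ h, u (x + h) (y + θ * h) ≤ u x y + a * h + b * (θ * h) := by
    intro h
    have := hab (x + h) (y + θ * h) (by
      rw [add_sub_cancel_left, add_sub_cancel_left, abs_mul]
      exact mul_le_of_le_one_left (abs_nonneg _) hθ)
    simpa using this
  have h1 := mul_le_mul_of_nonneg_left (key h₁) hα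
  have h2 := mul_le_mul_of_nonneg_left (key h₂) hβ
  have h3 : α * (u x y + a * h₁ + b * (θ * h₁)) + β * (u x y + a * h₂ + b * (θ * h₂))
      = (α + β) * u x y + (a + b * θ) * (α * h₁ + β * h₂) := by ring
  rw [h0, hαβ] at h3
  linarith

/-- The building block of the Burkholder function for exponents below two. -/
noncomputable def lowKernel (t x y : ℝ) : ℝ :=
  if |x| + |y| ≤ t then y ^ 2 - x ^ 2 else t ^ 2 - 2 * |x| * t

/-- The building block of the Burkholder function for exponents above two. -/
noncomputable def highKernel (t x y : ℝ) : ℝ :=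
  if |x| + |y| ≤ t then 0 else (|y| - t) ^ 2 - x ^ 2

/-- Inside the diamond the second-order error of y² - x² is (y' - y)² - (x' - x)², nonpositive on
the cone. Outside, the kernel is a concave function of x alone, which majorizes the kernel
everywhere (`hle`). -/
lemma zigzagConcave_lowKernel {t : ℝ} (ht : 0 < t) : ZigzagConcave (lowKernel t) := by
  have hle : ∀ x y, lowKernel t x y ≤ t ^ 2 - 2 * |x| * t := by
    intro x y
    unfold lowKernel
    split_ifs with h
    · have h1 : |y| ^ 2 ≤ (t - |x|) ^ 2 := by
        apply pow_le_pow_left₀ (abs_nonneg y); linarith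
      rw [sq_abs] at h1
      nlinarith [sq_abs x]
    · exact le_rfl
  apply ZigzagConcave.of_supergradient
  intro x y
  by_cases hxy : |x| + |y| ≤ t
  · refine ⟨-2 * x, 2 * y, fun x' y' hk => ?_⟩
    have hsq : (y' - y) ^ 2 ≤ (x' - x) ^ 2 := sq_le_sq.2 hk
    have e : lowKernel t x y = y ^ 2 - x ^ 2 := if_pos hxy
    rw [e]
    by_cases h' : |x'| + |y'| ≤ t
    · have e' : lowKernel t x' y' = y' ^ 2 - x' ^ 2 := if_pos h'
      rw [e']
      nlinarith
    · have e' : lowKernel t x' y' = t ^ 2 - 2 * |x'| * t := if_neg h'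
      rw [e']
      push Not at h'
      -- The tangent plane at (x, y) equals y'² - x'² + (x' - x)² - (y' - y)²; adding x'² to both
      -- sides completes the square.
      suffices h : (|x'| - t) ^ 2 ≤ y' ^ 2 + (x' - x) ^ 2 - (y' - y) ^ 2 by
        nlinarith [sq_abs x']
      by_cases hx' : |x'| ≤ t
      · have : (t - |x'|) ^ 2 ≤ |y'| ^ 2 := by
          apply pow_le_pow_left₀ <;> linarith
        rw [sq_abs] at this
        nlinarith
      · push Not at hx'
        have h1 : |x'| ≤ |x| + |x' - x| := by
          have := abs_add_le x (x' - x); simpa using this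
        have h2 : (|x'| - t) ^ 2 ≤ (|x' - x| - |y|) ^ 2 := by
          apply pow_le_pow_left₀ <;> linarith
        have h3 : -(y * (y' - y)) ≤ |y| * |x' - x| := by
          calc -(y * (y' - y)) ≤ |y * (y' - y)| := neg_le_abs _
            _ = |y| * |y' - y| := abs_mul _ _
            _ ≤ _ := by gcongr
        nlinarith [sq_abs y, sq_abs (x' - x)]
  · have e : lowKernel t x y = t ^ 2 - 2 * |x| * t := if_neg hxy
    -- At the kink x = 0 the sign is 0, which is an admissible slope.
    refine ⟨-2 * t * (SignType.sign x : ℝ), 0, fun x' y' _ => ?_⟩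
    rw [e]
    refine (hle x' y').trans ?_
    have h1 : (SignType.sign x : ℝ) * x = |x| := sign_mul_self x
    have h2 : (SignType.sign x : ℝ) * x' ≤ |x'| := by
      rcases lt_trichotomy x 0 with h | h | h
      · simp [sign_neg h, neg_le_abs]
      · simp [h]
      · simp [sign_pos h, le_abs_self]
    nlinarith

/-- From a point of the diamond the cone only reaches points with |y'| - t ≤ |x'|, where the kernel
is nonpositive. From outside, the tangent plane of the quadratic branch majorizes both branches on
the cone. -/
lemma zigzagConcave_highKernel {t : ℝ} (ht : 0 < t) : ZigzagConcave (highKernel t) := by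
  apply ZigzagConcave.of_supergradient
  intro x y
  by_cases hxy : |x| + |y| ≤ t
  · refine ⟨0, 0, fun x' y' hk => ?_⟩
    have e : highKernel t x y = 0 := if_pos hxy
    rw [e]
    by_cases h' : |x'| + |y'| ≤ t
    · have e' : highKernel t x' y' = 0 := if_pos h'
      simp [e']
    · have e' : highKernel t x' y' = (|y'| - t) ^ 2 - x' ^ 2 := if_neg h'
      rw [e']
      push Not at h'
      have : |(|y'| - t)| ≤ |x'| := by
        rw [abs_le]
        constructor
        · linarith
        · have h1 : |y'| ≤ |y| + |y' - y| := by
            have := abs_add_le y (y' - y); simpa using this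
          have h2 : |x' - x| ≤ |x'| + |x| := abs_sub _ _
          linarith
      have := sq_le_sq.2 this
      linarith
  · have e : highKernel t x y = (|y| - t) ^ 2 - x ^ 2 := if_neg hxy
    -- A sign of y that is never 0: s² = 1 is needed, and at y = 0 the kink of (|y| - t)² points
    -- upwards, so either choice works.
    obtain ⟨s, hs, hsy⟩ : ∃ s : ℝ, (s = 1 ∨ s = -1) ∧ s * y = |y| := by
      rcases abs_choice y with h | h
      · exact ⟨1, Or.inl rfl, by rw [h, one_mul]⟩
      · exact ⟨-1, Or.inr rfl, by rw [h]; ring⟩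
    have hs2 : s * s = 1 := by rcases hs with h | h <;> rw [h] <;> norm_num
    refine ⟨-2 * x, 2 * (|y| - t) * s, fun x' y' hk => ?_⟩
    have hsq : (y' - y) ^ 2 ≤ (x' - x) ^ 2 := sq_le_sq.2 hk
    have hsy' : s * y' ≤ |y'| ∧ -|y'| ≤ s * y' := by
      have h1 := le_abs_self y'
      have h2 := neg_le_abs y'
      rcases hs with h | h <;> rw [h] <;> constructor <;> linarith
    have hR : (|y| - t) ^ 2 - x ^ 2 + -2 * x * (x' - x) + 2 * (|y| - t) * s * (y' - y)
        = (s * y' - t) ^ 2 - x' ^ 2 + (x' - x) ^ 2 - (y' - y) ^ 2 := by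
      rw [← hsy]
      linear_combination (-(y' - y) ^ 2) * hs2
    rw [e, hR]
    by_cases h' : |x'| + |y'| ≤ t
    · have e' : highKernel t x' y' = 0 := if_pos h'
      rw [e']
      have : |x'| ^ 2 ≤ (t - s * y') ^ 2 := by
        apply pow_le_pow_left₀ (abs_nonneg _); linarith
      rw [sq_abs] at this
      nlinarith
    · have e' : highKernel t x' y' = (|y'| - t) ^ 2 - x' ^ 2 := if_neg h'
      rw [e']
      have h1 : (|y'|) ^ 2 = (s * y') ^ 2 := by
        rw [sq_abs]; linear_combination (-y' ^ 2) * hs2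
      nlinarith

/-- The kernel is homogeneous of degree 2 in (t, x, y), so the weight t^(p - 3) makes the integral
homogeneous of degree p. Convergence at 0 uses p > 1, and at infinity p < 2. -/
lemma lowKernel_integral {p : ℝ} (hp : 1 < p) (hp2 : p < 2) (x y : ℝ) :
    IntegrableOn (fun t : ℝ => t ^ (p - 3) * lowKernel t x y) (Set.Ioi 0) ∧
    ∫ t in Set.Ioi (0 : ℝ), t ^ (p - 3) * lowKernel t x y =
      (|x| + |y|) ^ (p - 1) * ((1 / p + 1 / (2 - p)) * |y| -
        (2 / (p - 1) + 1 / (2 - p) - 1 / p) * |x|) := by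
  set r := |x| + |y| with hr
  have hr0 : 0 ≤ r := by positivity
  rcases hr0.eq_or_lt with h0 | hrpos
  · have hx : x = 0 := by
      have := abs_nonneg x; have := abs_nonneg y
      exact abs_eq_zero.1 (by linarith)
    have hy : y = 0 := by
      have := abs_nonneg x; have := abs_nonneg y
      exact abs_eq_zero.1 (by linarith)
    subst hx hy
    have hz : ∀ t ∈ Set.Ioi (0 : ℝ), t ^ (p - 3) * lowKernel t 0 0 = 0 := by
      intro t ht
      simp [lowKernel, (Set.mem_Ioi.1 ht).le]
    refine ⟨integrableOn_zero.congr_fun (fun t ht => (hz t ht).symm) measurableSet_Ioi, ?_⟩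
    rw [setIntegral_congr_fun measurableSet_Ioi hz]
    simp
  have e1 : ∀ t ∈ Set.Ioc 0 r, t ^ (p - 3) * lowKernel t x y
      = t ^ (p - 1) - 2 * |x| * t ^ (p - 2) := by
    intro t ht
    have hk : lowKernel t x y = t ^ 2 - 2 * |x| * t := by
      unfold lowKernel
      split_ifs with h
      -- Both branches agree on the boundary t = |x| + |y|.
      · have : t = |x| + |y| := le_antisymm ht.2 h
        rw [this, ← sq_abs x, ← sq_abs y]; ring
      · rfl
    rw [hk, show p - 1 = (p - 3) + (2 : ℕ) by push_cast; ring, show p - 2 = (p - 3) + 1 by ring,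
      Real.rpow_add_natCast ht.1.ne', Real.rpow_add_one ht.1.ne']
    ring
  have e2 : ∀ t ∈ Set.Ioi r, t ^ (p - 3) * lowKernel t x y = t ^ (p - 3) * (y ^ 2 - x ^ 2) := by
    intro t ht
    rw [lowKernel, if_pos (le_of_lt ht)]
  have i1 : IntegrableOn (fun t : ℝ => t ^ (p - 1)) (Set.Ioc 0 r) := by
    have := intervalIntegral.intervalIntegrable_rpow' (a := 0) (b := r) (r := p - 1) (by linarith)
    exact (intervalIntegrable_iff_integrableOn_Ioc_of_le hr0).1 this
  have i2 : IntegrableOn (fun t : ℝ => t ^ (p - 2)) (Set.Ioc 0 r) := by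
    have := intervalIntegral.intervalIntegrable_rpow' (a := 0) (b := r) (r := p - 2) (by linarith)
    exact (intervalIntegrable_iff_integrableOn_Ioc_of_le hr0).1 this
  have i3 : IntegrableOn (fun t : ℝ => t ^ (p - 3)) (Set.Ioi r) :=
    integrableOn_Ioi_rpow_of_lt (by linarith) hrpos
  have I1 : IntegrableOn (fun t : ℝ => t ^ (p - 3) * lowKernel t x y) (Set.Ioc 0 r) :=
    (i1.sub (i2.const_mul (2 * |x|))).congr_fun (fun t ht => (e1 t ht).symm) measurableSet_Ioc
  have I2 : IntegrableOn (fun t : ℝ => t ^ (p - 3) * lowKernel t x y) (Set.Ioi r) :=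
    IntegrableOn.congr_fun (Integrable.mul_const i3 _) (fun t ht => (e2 t ht).symm) measurableSet_Ioi
  have hU : Set.Ioi (0 : ℝ) = Set.Ioc 0 r ∪ Set.Ioi r := (Set.Ioc_union_Ioi_eq_Ioi hr0).symm
  have hdisj : Disjoint (Set.Ioc 0 r) (Set.Ioi r) := Set.Ioc_disjoint_Ioi le_rfl
  refine ⟨hU ▸ I1.union I2, ?_⟩
  rw [hU, setIntegral_union hdisj measurableSet_Ioi I1 I2,
    setIntegral_congr_fun measurableSet_Ioc e1, setIntegral_congr_fun measurableSet_Ioi e2,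
    integral_sub i1 (i2.const_mul _), integral_const_mul, integral_mul_const,
    integral_Ioi_rpow_of_lt (by linarith) hrpos, ← intervalIntegral.integral_of_le hr0,
    ← intervalIntegral.integral_of_le hr0, integral_rpow (Or.inl (by linarith)),
    integral_rpow (Or.inl (by linarith)), Real.zero_rpow (by linarith),
    Real.zero_rpow (by linarith), Real.rpow_add_one hrpos.ne' (p - 1),
    show p - 2 + 1 = p - 1 by ring, show p - 3 + 1 = p - 1 - 1 by ring,
    Real.rpow_sub_one hrpos.ne' (p - 1), ← sq_abs x, ← sq_abs y]
  have h1 : p ≠ 0 := by linarith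
  have h2 : p - 1 ≠ 0 := by linarith
  have h3 : 2 - p ≠ 0 := by linarith
  have h5 : p - 1 - 1 = -(2 - p) := by ring
  have hrr : r ≠ 0 := hrpos.ne'
  have hxy : (|y| ^ 2 - |x| ^ 2) = r * (|y| - |x|) := by rw [hr]; ring
  rw [hxy, h5, show p - 1 + 1 = p by ring]
  generalize r ^ (p - 1) = P
  field_simp
  rw [hr]
  ring

/-- This kernel vanishes for t > |x| + |y|, so only convergence at 0 matters; there t^(p - 3) is
integrable because p > 2. -/
lemma highKernel_integral {p : ℝ} (hp2 : 2 < p) (x y : ℝ) :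
    IntegrableOn (fun t : ℝ => t ^ (p - 3) * highKernel t x y) (Set.Ioi 0) ∧
    ∫ t in Set.Ioi (0 : ℝ), t ^ (p - 3) * highKernel t x y =
      (|x| + |y|) ^ (p - 1) * ((1 / (p - 2) - 2 / (p - 1) + 1 / p) * |y| -
        (1 / (p - 2) - 1 / p) * |x|) := by
  set r := |x| + |y| with hr
  have hr0 : 0 ≤ r := by positivity
  have e1 : ∀ t ∈ Set.Ioc 0 r, t ^ (p - 3) * highKernel t x y
      = t ^ (p - 1) - 2 * |y| * t ^ (p - 2) + (|y| ^ 2 - |x| ^ 2) * t ^ (p - 3) := by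
    intro t ht
    have hk : highKernel t x y = (|y| - t) ^ 2 - x ^ 2 := by
      unfold highKernel
      split_ifs with h
      · have : t = |x| + |y| := le_antisymm ht.2 h
        rw [this, ← sq_abs x]; ring
      · rfl
    rw [hk, show p - 1 = (p - 3) + (2 : ℕ) by push_cast; ring, show p - 2 = (p - 3) + 1 by ring,
      Real.rpow_add_natCast ht.1.ne', Real.rpow_add_one ht.1.ne', ← sq_abs x]
    ring
  have e2 : ∀ t ∈ Set.Ioi r, t ^ (p - 3) * highKernel t x y = 0 := by
    intro t ht
    rw [highKernel, if_pos (le_of_lt ht), mul_zero]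
  have ii : ∀ s : ℝ, -1 < s → IntegrableOn (fun t : ℝ => t ^ s) (Set.Ioc 0 r) := by
    intro s hs
    have := intervalIntegral.intervalIntegrable_rpow' (a := 0) (b := r) hs
    exact (intervalIntegrable_iff_integrableOn_Ioc_of_le hr0).1 this
  have i1 := ii (p - 1) (by linarith)
  have i2 := ii (p - 2) (by linarith)
  have i3 := ii (p - 3) (by linarith)
  have I1 : IntegrableOn (fun t : ℝ => t ^ (p - 3) * highKernel t x y) (Set.Ioc 0 r) :=
    ((i1.sub (i2.const_mul (2 * |y|))).add (i3.const_mul (|y| ^ 2 - |x| ^ 2))).congr_fun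
      (fun t ht => (e1 t ht).symm) measurableSet_Ioc
  have I2 : IntegrableOn (fun t : ℝ => t ^ (p - 3) * highKernel t x y) (Set.Ioi r) :=
    integrableOn_zero.congr_fun (fun t ht => (e2 t ht).symm) measurableSet_Ioi
  have hU : Set.Ioi (0 : ℝ) = Set.Ioc 0 r ∪ Set.Ioi r := (Set.Ioc_union_Ioi_eq_Ioi hr0).symm
  have hdisj : Disjoint (Set.Ioc 0 r) (Set.Ioi r) := Set.Ioc_disjoint_Ioi le_rfl
  refine ⟨hU ▸ I1.union I2, ?_⟩
  rw [hU, setIntegral_union hdisj measurableSet_Ioi I1 I2,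
    setIntegral_congr_fun measurableSet_Ioc e1, setIntegral_congr_fun measurableSet_Ioi e2,
    integral_add (f := fun t : ℝ => t ^ (p - 1) - 2 * |y| * t ^ (p - 2))
      (i1.sub (i2.const_mul _)) (i3.const_mul _),
    integral_sub i1 (i2.const_mul _), integral_const_mul, integral_const_mul,
    ← intervalIntegral.integral_of_le hr0, ← intervalIntegral.integral_of_le hr0,
    ← intervalIntegral.integral_of_le hr0, integral_rpow (Or.inl (by linarith)),
    integral_rpow (Or.inl (by linarith)), integral_rpow (Or.inl (by linarith)),
    Real.zero_rpow (by linarith), Real.zero_rpow (by linarith), Real.zero_rpow (by linarith),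
    integral_zero]
  rcases hr0.eq_or_lt with h0 | hrpos
  · rw [← h0]
    simp [Real.zero_rpow (show p - 1 ≠ 0 by linarith), Real.zero_rpow (show p ≠ 0 by linarith),
      Real.zero_rpow (show p - 2 + 1 ≠ 0 by linarith),
      Real.zero_rpow (show p - 3 + 1 ≠ 0 by linarith)]
  rw [Real.rpow_add_one hrpos.ne' (p - 1), show p - 2 + 1 = p - 1 by ring,
    show p - 3 + 1 = p - 1 - 1 by ring, Real.rpow_sub_one hrpos.ne' (p - 1)]
  have h1 : p ≠ 0 := by linarith
  have h2 : p - 1 ≠ 0 := by linarith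
  have h3 : p - 2 ≠ 0 := by linarith
  have hrr : r ≠ 0 := hrpos.ne'
  have hxy : (|y| ^ 2 - |x| ^ 2) = r * (|y| - |x|) := by rw [hr]; ring
  rw [hxy, show p - 1 + 1 = p by ring, show p - 1 - 1 = p - 2 by ring]
  generalize r ^ (p - 1) = P
  field_simp
  rw [hr]
  ring

lemma ZigzagConcave.integral {K : ℝ → ℝ → ℝ → ℝ} {U : ℝ → ℝ → ℝ} {w : ℝ → ℝ}
    (hw : ∀ t, 0 < t → 0 ≤ w t) (hK : ∀ t, 0 < t → ZigzagConcave (K t))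
    (hU : ∀ x y, IntegrableOn (fun t : ℝ => w t * K t x y) (Set.Ioi 0) ∧
      ∫ t in Set.Ioi (0 : ℝ), w t * K t x y = U x y) : ZigzagConcave U := by
  intro x y h₁ h₂ α β θ hα hβ hαβ h0 hθ
  rw [← (hU _ _).2, ← (hU _ _).2, ← (hU _ _).2, ← integral_const_mul, ← integral_const_mul,
    ← integral_add ((hU _ _).1.const_mul _) ((hU _ _).1.const_mul _)]
  refine setIntegral_mono_on (((hU _ _).1.const_mul _).add ((hU _ _).1.const_mul _)) (hU _ _).1
    measurableSet_Ioi fun t ht => ?_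
  have := mul_le_mul_of_nonneg_left (hK t ht x y h₁ h₂ α β θ hα hβ hαβ h0 hθ) (hw t ht)
  linarith

/-- The threshold is |y| = K|x| with K = 2b/a. Above it, b|x| is at most half of a|y|; below it,
|y|^p and the negative term are both bounded by multiples of |x|^p, and these add up to the
constant. -/
lemma burkholder_lower_bound {p a b : ℝ} (hp : 1 < p) (ha : 0 < a) (hb : 0 < b) (x y : ℝ) :
    a / 2 * |y| ^ p - (b * (1 + 2 * b / a) ^ (p - 1) + a / 2 * (2 * b / a) ^ p) * |x| ^ p ≤
      (|x| + |y|) ^ (p - 1) * (a * |y| - b * |x|) := by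
  have hp0 : 0 < p := by linarith
  have hsplit : ∀ z : ℝ, 0 ≤ z → z ^ p = z ^ (p - 1) * z := by
    intro z hz
    rcases hz.eq_or_lt with h | h
    · rw [← h, Real.zero_rpow hp0.ne', mul_zero]
    · rw [← Real.rpow_add_one h.ne']; congr 1; ring
  set K := 2 * b / a with hK
  have hKp : 0 < K := by positivity
  have hx := abs_nonneg x
  have hy := abs_nonneg y
  by_cases h : K * |x| ≤ |y|
  · have h1 : b * |x| ≤ a / 2 * |y| := by
      have : K * a = 2 * b := by rw [hK]; field_simp
      nlinarith
    have h2 : |y| ^ (p - 1) ≤ (|x| + |y|) ^ (p - 1) :=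
      Real.rpow_le_rpow hy (by linarith) (by linarith)
    have h3 : 0 ≤ (b * (1 + K) ^ (p - 1) + a / 2 * K ^ p) * |x| ^ p := by positivity
    have h4 : |y| ^ (p - 1) * (a / 2 * |y|) ≤ (|x| + |y|) ^ (p - 1) * (a * |y| - b * |x|) :=
      mul_le_mul h2 (by linarith) (by positivity) (by positivity)
    rw [hsplit _ hy]
    linarith
  · push Not at h
    have h1 : |y| ^ p ≤ K ^ p * |x| ^ p := by
      rw [← Real.mul_rpow hKp.le hx]
      exact Real.rpow_le_rpow hy h.le hp0.le
    have h2 : (|x| + |y|) ^ (p - 1) ≤ (1 + K) ^ (p - 1) * |x| ^ (p - 1) := by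
      rw [← Real.mul_rpow (by positivity) hx]
      exact Real.rpow_le_rpow (by positivity) (by linarith) (by linarith)
    have h3 : (|x| + |y|) ^ (p - 1) * (b * |x|) ≤ b * (1 + K) ^ (p - 1) * |x| ^ p := by
      rw [hsplit _ hx]
      have := mul_le_mul_of_nonneg_right h2 (show 0 ≤ b * |x| by positivity)
      linarith
    have h4 : 0 ≤ (|x| + |y|) ^ (p - 1) * (a * |y|) := by positivity
    have h5 := mul_le_mul_of_nonneg_left h1 (show 0 ≤ a / 2 by positivity)
    nlinarith

/-- A Burkholder function for every exponent `p > 1`. -/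
theorem exists_burkholder_function {p : ℝ} (hp : 1 < p) :
    ∃ (U : ℝ → ℝ → ℝ) (c C : ℝ), 0 < c ∧ 0 ≤ C ∧ ZigzagConcave U ∧
      (∀ x y, |y| ≤ |x| → U x y ≤ 0) ∧ ∀ x y, c * |y| ^ p - C * |x| ^ p ≤ U x y := by
  have main : ∀ a b : ℝ, 0 < a → a ≤ b →
      ZigzagConcave (fun x y => (|x| + |y|) ^ (p - 1) * (a * |y| - b * |x|)) →
      ∃ (U : ℝ → ℝ → ℝ) (c C : ℝ), 0 < c ∧ 0 ≤ C ∧ ZigzagConcave U ∧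
      (∀ x y, |y| ≤ |x| → U x y ≤ 0) ∧ ∀ x y, c * |y| ^ p - C * |x| ^ p ≤ U x y := by
    intro a b ha hab hz
    have hb : 0 < b := by linarith
    refine ⟨_, a / 2, _, by positivity, ?_, hz, ?_, burkholder_lower_bound hp ha hb⟩
    · positivity
    · intro x y hxy
      have := mul_le_mul hab hxy (abs_nonneg y) hb.le
      exact mul_nonpos_of_nonneg_of_nonpos (by positivity) (by linarith)
  have hp1 : 0 < p - 1 := by linarith
  have hp0 : 0 < p := by linarith
  -- For p ≠ 2, both choices below satisfy b - a = 2/(p - 1) - 2/p, so this yields a ≤ b.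
  have hcmp : 1 / p < 1 / (p - 1) := one_div_lt_one_div_of_lt hp1 (by linarith)
  have e1 : 2 / (p - 1) = 2 * (1 / (p - 1)) := by ring
  rcases lt_trichotomy p 2 with h | h | h
  · have h2 : 0 < 2 - p := by linarith
    refine main (1 / p + 1 / (2 - p)) (2 / (p - 1) + 1 / (2 - p) - 1 / p) (by positivity)
      (by rw [e1]; linarith) ?_
    exact ZigzagConcave.integral (w := fun t => t ^ (p - 3)) (fun t ht => by positivity)
      (fun t ht => zigzagConcave_lowKernel ht) (fun x y => lowKernel_integral hp h x y)
  · refine main 1 1 one_pos le_rfl ?_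
    apply ZigzagConcave.of_supergradient
    intro x y
    refine ⟨-2 * x, 2 * y, fun x' y' hk => ?_⟩
    have hsq : (y' - y) ^ 2 ≤ (x' - x) ^ 2 := sq_le_sq.2 hk
    have e : ∀ x y : ℝ, (|x| + |y|) ^ (p - 1) * (1 * |y| - 1 * |x|) = y ^ 2 - x ^ 2 := by
      intro x y
      rw [h, show (2 : ℝ) - 1 = 1 by norm_num, Real.rpow_one, ← sq_abs x, ← sq_abs y]
      ring
    rw [e, e]
    nlinarith
  · have h2 : 0 < p - 2 := by linarith
    have ha : 0 < 1 / (p - 2) - 2 / (p - 1) + 1 / p := by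
      have : 1 / (p - 2) - 2 / (p - 1) + 1 / p = 2 / ((p - 2) * (p - 1) * p) := by
        field_simp; ring
      rw [this]; positivity
    refine main (1 / (p - 2) - 2 / (p - 1) + 1 / p) (1 / (p - 2) - 1 / p) ha
      (by rw [e1]; linarith) ?_
    exact ZigzagConcave.integral (w := fun t => t ^ (p - 3)) (fun t ht => by positivity)
      (fun t ht => zigzagConcave_highKernel ht) (fun x y => highKernel_integral h x y)

/-! ### Haar expansions along a binary tree of cells. -/

section Haar

variable {α : Type*}

/-- The cells of the successive binary partitions generated by `S 0, S 1, …`. -/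
def haarCell (S : ℕ → Set α) : List Bool → Set α
  | [] => Set.univ
  | true :: l => haarCell S l ∩ S l.length
  | false :: l => haarCell S l \ S l.length

lemma haarCell_cons_subset (S : ℕ → Set α) (b : Bool) (l : List Bool) :
    haarCell S (b :: l) ⊆ haarCell S l := by
  cases b
  · exact Set.sdiff_subset
  · exact Set.inter_subset_left

lemma disjoint_haarCell (S : ℕ → Set α) (l : List Bool) :
    Disjoint (haarCell S (true :: l)) (haarCell S (false :: l)) := by
  rw [Set.disjoint_left]
  rintro x ⟨_, h1⟩ ⟨_, h2⟩
  exact h2 h1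

lemma haarCell_union (S : ℕ → Set α) (l : List Bool) :
    haarCell S (true :: l) ∪ haarCell S (false :: l) = haarCell S l :=
  Set.inter_union_sdiff _ _

lemma haarCell_subset_or_disjoint (S : ℕ → Set α) (n : ℕ) (l : List Bool) (hl : n < l.length) :
    haarCell S l ⊆ S n ∨ Disjoint (haarCell S l) (S n) := by
  induction l with
  | nil => simp at hl
  | cons b l ih =>
    rcases Nat.lt_succ_iff_lt_or_eq.1 hl with h | h
    · rcases ih h with h | h
      · exact Or.inl ((haarCell_cons_subset S b l).trans h)
      · exact Or.inr (h.mono_left (haarCell_cons_subset S b l))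
    · subst h
      cases b
      · exact Or.inr Set.disjoint_sdiff_left
      · exact Or.inl Set.inter_subset_right

/-- Sum of `a` over the `N` first generations of descendants of `l`. -/
def treeSum {M : Type*} [AddCommMonoid M] (a : List Bool → M) : ℕ → List Bool → M
  | 0, _ => 0
  | N + 1, l => a l + (treeSum a N (true :: l) + treeSum a N (false :: l))

/-- The descendants of `l` are the lists with suffix `l`. This links the recursion, which suits
induction along the tree, with sums over arbitrary finite sets of cells. -/
lemma treeSum_eq_sum {M : Type*} [AddCommMonoid M] {a : List Bool → M} {F : Finset (List Bool)}
    (ha : ∀ l ∉ F, a l = 0) (N : ℕ) (l : List Bool) :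
    treeSum a N l = ∑ v ∈ F, if l <:+ v ∧ v.length < l.length + N then a v else 0 := by
  classical
  induction N generalizing l with
  | zero =>
    rw [treeSum]
    symm
    apply Finset.sum_eq_zero
    intro v _
    rw [if_neg]
    rintro ⟨h1, h2⟩
    have := h1.length_le
    omega
  | succ N ih =>
    have hl : a l = ∑ v ∈ F, if v = l then a v else 0 := by
      rw [Finset.sum_ite_eq']
      split_ifs with h
      · rfl
      · exact ha l h
    rw [treeSum, ih, ih, hl, ← Finset.sum_add_distrib, ← Finset.sum_add_distrib]
    apply Finset.sum_congr rfl
    intro v _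
    by_cases hv : l <:+ v
    · obtain ⟨t, rfl⟩ := hv
      -- The letter adjacent to `l` decides which child's subtree contains the descendant.
      rcases List.eq_nil_or_concat t with rfl | ⟨t, b, rfl⟩
      · have h1 : ∀ b, ¬ (b :: l) <:+ l := fun b h => by
          have := h.length_le
          simp at this
        simp [h1]
      · have h1 : ∀ b', (b' :: l) <:+ (t ++ [b] ++ l) ↔ b' = b := by
          intro b'
          rw [List.append_assoc]
          constructor
          · intro h
            have h2 := List.suffix_of_suffix_length_le h
              (List.suffix_append t ([b] ++ l)) (by simp)
            have h3 := h2.eq_of_length (by simp)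
            simpa using h3
          · rintro rfl
            exact List.suffix_append t ([b'] ++ l)
        have h2 : t ++ [b] ++ l ≠ l := by
          intro h
          have := congrArg List.length h
          simp at this
          omega
        simp only [List.concat_eq_append, h1, h2, if_false, zero_add, List.suffix_append,
          true_and, List.length_cons]
        cases b <;> simp <;> congr 1 <;> simp <;> omega
    · have h1 : ∀ b, ¬ (b :: l) <:+ v := fun b h => hv ((List.suffix_cons b l).trans h)
      have h2 : v ≠ l := by
        rintro rfl
        exact hv List.suffix_rfl
      simp [h1, h2, hv]

lemma treeSum_nil_eq_sum {M : Type*} [AddCommMonoid M] {a : List Bool → M}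
    {F : Finset (List Bool)} (ha : ∀ l ∉ F, a l = 0) {N : ℕ} (hN : ∀ l ∈ F, l.length < N) :
    treeSum a N [] = ∑ v ∈ F, a v := by
  rw [treeSum_eq_sum ha]
  apply Finset.sum_congr rfl
  intro v hv
  rw [if_pos]
  simpa using hN v hv

variable [MeasurableSpace α]

lemma measurableSet_haarCell {S : ℕ → Set α} (hS : ∀ n, MeasurableSet (S n)) (l : List Bool) :
    MeasurableSet (haarCell S l) := by
  induction l with
  | nil => exact MeasurableSet.univ
  | cons b l ih =>
    cases b
    · exact ih.diff (hS _)
    · exact ih.inter (hS _)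

open Classical in
/-- The Haar function which splits the cell `l` into its two children. -/
noncomputable def haarFun (μ : Measure α) (S : ℕ → Set α) (l : List Bool) (x : α) : ℝ :=
  if x ∈ haarCell S (true :: l) then
    μ.real (haarCell S (false :: l)) / μ.real (haarCell S l)
  else if x ∈ haarCell S (false :: l) then
    -(μ.real (haarCell S (true :: l)) / μ.real (haarCell S l))
  else 0

/-- The difference of the averages of `f` over the two children of the cell `l`. -/
noncomputable def haarCoef (μ : Measure α) (S : ℕ → Set α) (f : α → ℝ) (l : List Bool) : ℝ :=
  (⨍ x in haarCell S (true :: l), f x ∂μ) - ⨍ x in haarCell S (false :: l), f x ∂μ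

variable {μ : Measure α} {S : ℕ → Set α}

lemma haarFun_of_mem_true {l : List Bool} {x : α} (hx : x ∈ haarCell S (true :: l)) :
    haarFun μ S l x = μ.real (haarCell S (false :: l)) / μ.real (haarCell S l) :=
  if_pos hx

lemma haarFun_of_mem_false {l : List Bool} {x : α} (hx : x ∈ haarCell S (false :: l)) :
    haarFun μ S l x = -(μ.real (haarCell S (true :: l)) / μ.real (haarCell S l)) := by
  rw [haarFun, if_neg fun h => Set.disjoint_left.1 (disjoint_haarCell S l) h hx, if_pos hx]

lemma haarFun_of_notMem {l : List Bool} {x : α} (hx : x ∉ haarCell S l) :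
    haarFun μ S l x = 0 := by
  rw [haarFun, if_neg fun h => hx (haarCell_cons_subset S _ _ h),
    if_neg fun h => hx (haarCell_cons_subset S _ _ h)]

lemma abs_haarFun_le [IsFiniteMeasure μ] (l : List Bool) (x : α) : |haarFun μ S l x| ≤ 1 := by
  have h : ∀ b, |μ.real (haarCell S (b :: l)) / μ.real (haarCell S l)| ≤ 1 := by
    intro b
    rw [abs_of_nonneg (by positivity)]
    exact div_le_one_of_le₀ (measureReal_mono (haarCell_cons_subset S b l)) measureReal_nonneg
  unfold haarFun
  split_ifs
  · exact h _
  · rw [abs_neg]; exact h _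
  · simp

lemma measurable_haarFun (hS : ∀ n, MeasurableSet (S n)) (l : List Bool) :
    Measurable (haarFun μ S l) :=
  Measurable.ite (measurableSet_haarCell hS _) measurable_const
    (Measurable.ite (measurableSet_haarCell hS _) measurable_const measurable_const)

lemma finite_range_haarFun (l : List Bool) : (Set.range (haarFun μ S l)).Finite := by
  refine Set.Finite.subset (s := {μ.real (haarCell S (false :: l)) / μ.real (haarCell S l),
    -(μ.real (haarCell S (true :: l)) / μ.real (haarCell S l)), 0}) (by simp) ?_
  rintro _ ⟨x, rfl⟩
  unfold haarFun
  split_ifs <;> simp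

/-- The partial sums of the Haar expansion of `f` below `l`, with multipliers `θ`. -/
noncomputable def haarSum (μ : Measure α) (S : ℕ → Set α) (f : α → ℝ) (θ : List Bool → ℝ) (N : ℕ)
    (l : List Bool) : α → ℝ :=
  treeSum (fun v => (θ v * haarCoef μ S f v) • haarFun μ S v) N l

lemma haarSum_of_notMem {f : α → ℝ} {θ : List Bool → ℝ} {N : ℕ} {l : List Bool} {x : α}
    (hx : x ∉ haarCell S l) : haarSum μ S f θ N l x = 0 := by
  induction N generalizing l with
  | zero => rfl
  | succ N ih =>
    have h1 := ih (l := true :: l) (fun h => hx (haarCell_cons_subset S _ _ h))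
    have h2 := ih (l := false :: l) (fun h => hx (haarCell_cons_subset S _ _ h))
    simp only [haarSum] at h1 h2
    simp [haarSum, treeSum, h1, h2, haarFun_of_notMem hx]

lemma haarSum_succ_of_mem {f : α → ℝ} {θ : List Bool → ℝ} {N : ℕ} {l : List Bool} {x : α}
    {b : Bool} (hx : x ∈ haarCell S (b :: l)) :
    haarSum μ S f θ (N + 1) l x =
      θ l * haarCoef μ S f l * haarFun μ S l x + haarSum μ S f θ N (b :: l) x := by
  cases b
  · have h1 := haarSum_of_notMem (μ := μ) (f := f) (θ := θ) (N := N)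
      (Set.disjoint_right.1 (disjoint_haarCell S l) hx)
    simp only [haarSum] at h1
    simp [haarSum, treeSum, h1]
  · have h1 := haarSum_of_notMem (μ := μ) (f := f) (θ := θ) (N := N)
      (Set.disjoint_left.1 (disjoint_haarCell S l) hx)
    simp only [haarSum] at h1
    simp [haarSum, treeSum, h1]

lemma measurable_haarSum (hS : ∀ n, MeasurableSet (S n)) (f : α → ℝ) (θ : List Bool → ℝ) (N : ℕ)
    (l : List Bool) : Measurable (haarSum μ S f θ N l) := by
  induction N generalizing l with
  | zero => exact measurable_const
  | succ N ih => exact ((measurable_haarFun hS l).const_smul _).add ((ih _).add (ih _))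

lemma haarSum_bounded [IsFiniteMeasure μ] (f : α → ℝ) (θ : List Bool → ℝ) (N : ℕ)
    (l : List Bool) : ∃ B, ∀ x, |haarSum μ S f θ N l x| ≤ B := by
  induction N generalizing l with
  | zero => exact ⟨0, fun x => by simp [haarSum, treeSum]⟩
  | succ N ih =>
    obtain ⟨B1, h1⟩ := ih (true :: l)
    obtain ⟨B2, h2⟩ := ih (false :: l)
    refine ⟨|θ l * haarCoef μ S f l| + (B1 + B2), fun x => ?_⟩
    refine (abs_add_le _ _).trans (add_le_add ?_ ((abs_add_le _ _).trans (add_le_add (h1 x) (h2 x))))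
    change |θ l * haarCoef μ S f l * haarFun μ S l x| ≤ _
    rw [abs_mul]
    exact mul_le_of_le_one_right (abs_nonneg _) (abs_haarFun_le l x)

lemma average_children [IsFiniteMeasure μ] (hS : ∀ n, MeasurableSet (S n)) {f : α → ℝ}
    (hf : Integrable f μ) (l : List Bool) :
    μ.real (haarCell S l) * (⨍ x in haarCell S l, f x ∂μ) =
      μ.real (haarCell S (true :: l)) * (⨍ x in haarCell S (true :: l), f x ∂μ) +
      μ.real (haarCell S (false :: l)) * (⨍ x in haarCell S (false :: l), f x ∂μ) := by
  have h : ∀ s, μ.real s * (⨍ x in s, f x ∂μ) = ∫ x in s, f x ∂μ := fun s => by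
    rw [← smul_eq_mul, measure_smul_setAverage _ (measure_ne_top μ s)]
  rw [h, h, h, ← haarCell_union S l, setIntegral_union (disjoint_haarCell S l)
    (measurableSet_haarCell hS _) hf.integrableOn hf.integrableOn]

lemma measureReal_children [IsFiniteMeasure μ] (hS : ∀ n, MeasurableSet (S n)) (l : List Bool) :
    μ.real (haarCell S l) =
      μ.real (haarCell S (true :: l)) + μ.real (haarCell S (false :: l)) := by
  rw [← haarCell_union S l, measureReal_union (disjoint_haarCell S l)
    (measurableSet_haarCell hS _)]

/-- Only the parent needs positive mass: if a child is null its average has the default value 0, and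
the mass-weighted identities remain valid. -/
lemma average_true [IsFiniteMeasure μ] (hS : ∀ n, MeasurableSet (S n)) {f : α → ℝ}
    (hf : Integrable f μ) {l : List Bool} (hl : μ.real (haarCell S l) ≠ 0) :
    (⨍ x in haarCell S (true :: l), f x ∂μ) = (⨍ x in haarCell S l, f x ∂μ) +
      haarCoef μ S f l * (μ.real (haarCell S (false :: l)) / μ.real (haarCell S l)) := by
  have h1 := average_children hS hf l
  have h2 := measureReal_children (μ := μ) hS l
  rw [haarCoef]
  field_simp
  linear_combination (⨍ x in haarCell S (true :: l), f x ∂μ) * h2 - h1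

lemma average_false [IsFiniteMeasure μ] (hS : ∀ n, MeasurableSet (S n)) {f : α → ℝ}
    (hf : Integrable f μ) {l : List Bool} (hl : μ.real (haarCell S l) ≠ 0) :
    (⨍ x in haarCell S (false :: l), f x ∂μ) = (⨍ x in haarCell S l, f x ∂μ) +
      haarCoef μ S f l * -(μ.real (haarCell S (true :: l)) / μ.real (haarCell S l)) := by
  have h1 := average_children hS hf l
  have h2 := measureReal_children (μ := μ) hS l
  rw [haarCoef]
  field_simp
  linear_combination (⨍ x in haarCell S (false :: l), f x ∂μ) * h2 - h1

lemma integrable_rpow_add_haarSum [IsFiniteMeasure μ] (hS : ∀ n, MeasurableSet (S n)) {p : ℝ}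
    (hp : 1 < p) (f : α → ℝ) (θ : List Bool → ℝ) (N : ℕ) (l : List Bool) (y : ℝ) :
    Integrable (fun x => |y + haarSum μ S f θ N l x| ^ p) μ := by
  obtain ⟨B, hB⟩ := haarSum_bounded (μ := μ) (S := S) f θ N l
  have hm : Measurable (fun x => |y + haarSum μ S f θ N l x| ^ p) :=
    ((measurable_const.add (measurable_haarSum hS f θ N l)).abs).pow_const p
  refine Integrable.of_bound hm.aestronglyMeasurable ((|y| + B) ^ p) (ae_of_all _ fun x => ?_)
  rw [Real.norm_of_nonneg (by positivity)]
  exact Real.rpow_le_rpow (abs_nonneg _)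
    ((abs_add_le _ _).trans (add_le_add le_rfl (hB x))) (by linarith)

lemma measureReal_mul_abs_average_rpow_le [IsFiniteMeasure μ] {p : ℝ} (hp : 1 < p) {f : α → ℝ}
    (hf : Integrable f μ) (hfp : Integrable (fun x => |f x| ^ p) μ) (s : Set α) :
    μ.real s * |⨍ x in s, f x ∂μ| ^ p ≤ ∫ x in s, |f x| ^ p ∂μ := by
  by_cases h0 : μ s = 0
  · rw [measureReal_def, h0]
    simp only [ENNReal.toReal_zero, zero_mul]
    exact integral_nonneg fun x => by positivity
  have h1 : |⨍ x in s, f x ∂μ| ^ p ≤ ⨍ x in s, |f x| ^ p ∂μ := by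
    have := ConvexOn.map_set_average_le (μ := μ) (t := s) (convexOn_rpow hp.le)
      ((Real.continuous_rpow_const (by linarith)).continuousOn) isClosed_Ici h0
      (measure_ne_top μ s) (f := fun x => |f x|) (ae_of_all _ fun x => abs_nonneg (f x))
      hf.abs.integrableOn hfp.integrableOn
    refine le_trans (Real.rpow_le_rpow (abs_nonneg _) ?_ (by linarith)) this
    rw [setAverage_eq, setAverage_eq, smul_eq_mul, smul_eq_mul, abs_mul,
      abs_of_nonneg (a := (μ.real s)⁻¹) (by positivity)]
    gcongr
    exact abs_integral_le_integral_abs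
  calc μ.real s * |⨍ x in s, f x ∂μ| ^ p ≤ μ.real s * ⨍ x in s, |f x| ^ p ∂μ := by gcongr
    _ = _ := by rw [← smul_eq_mul, measure_smul_setAverage _ (measure_ne_top μ s)]

/-- Splitting a cell moves the pair (average of f, value y of the transform) along a segment of
slope `θ l`, with weights proportional to the masses of the children, so the mass-weighted sum of U
does not increase. At the end, the lower bound on U and Jensen's inequality apply. The value y is
arbitrary because the induction hands the value reached so far to the children. -/
lemma haarSum_burkholder [IsFiniteMeasure μ] (hS : ∀ n, MeasurableSet (S n)) {p : ℝ} (hp : 1 < p)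
    {U : ℝ → ℝ → ℝ} {c C : ℝ} (hC : 0 ≤ C) (hU : ZigzagConcave U)
    (hUlow : ∀ x y, c * |y| ^ p - C * |x| ^ p ≤ U x y)
    {f : α → ℝ} (hf : Integrable f μ) (hfp : Integrable (fun x => |f x| ^ p) μ)
    {θ : List Bool → ℝ} (hθ : ∀ l, |θ l| ≤ 1) (N : ℕ) (l : List Bool) (y : ℝ) :
    c * ∫ x in haarCell S l, |y + haarSum μ S f θ N l x| ^ p ∂μ ≤
      μ.real (haarCell S l) * U (⨍ x in haarCell S l, f x ∂μ) y +
        C * ∫ x in haarCell S l, |f x| ^ p ∂μ := by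
  induction N generalizing l y with
  | zero =>
    have h1 : ∫ x in haarCell S l, |y + haarSum μ S f θ 0 l x| ^ p ∂μ
        = μ.real (haarCell S l) * |y| ^ p := by
      simp [haarSum, treeSum]
    rw [h1]
    have h2 := mul_le_mul_of_nonneg_left (hUlow (⨍ x in haarCell S l, f x ∂μ) y)
      (measureReal_nonneg (μ := μ) (s := haarCell S l))
    have h3 := mul_le_mul_of_nonneg_left
      (measureReal_mul_abs_average_rpow_le hp hf hfp (haarCell S l)) hC
    linarith
  | succ N ih =>
    by_cases h0 : μ.real (haarCell S l) = 0
    · have h1 : μ (haarCell S l) = 0 := (measureReal_eq_zero_iff).1 h0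
      rw [setIntegral_measure_zero _ h1, setIntegral_measure_zero _ h1, h0]
      simp
    set m := μ.real (haarCell S l) with hm
    set m₁ := μ.real (haarCell S (true :: l)) with hm₁
    set m₀ := μ.real (haarCell S (false :: l)) with hm₀
    have hmm : m = m₁ + m₀ := measureReal_children hS l
    set X := ⨍ x in haarCell S l, f x ∂μ with hX
    set k := haarCoef μ S f l with hk
    have e1 : ∫ x in haarCell S (true :: l), |y + haarSum μ S f θ (N + 1) l x| ^ p ∂μ
        = ∫ x in haarCell S (true :: l),
          |(y + θ l * (k * (m₀ / m))) + haarSum μ S f θ N (true :: l) x| ^ p ∂μ := by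
      refine setIntegral_congr_fun (measurableSet_haarCell hS _) fun x hx => ?_
      rw [haarSum_succ_of_mem hx, haarFun_of_mem_true hx]
      congr 2
      ring
    have e0 : ∫ x in haarCell S (false :: l), |y + haarSum μ S f θ (N + 1) l x| ^ p ∂μ
        = ∫ x in haarCell S (false :: l),
          |(y + θ l * (k * -(m₁ / m))) + haarSum μ S f θ N (false :: l) x| ^ p ∂μ := by
      refine setIntegral_congr_fun (measurableSet_haarCell hS _) fun x hx => ?_
      rw [haarSum_succ_of_mem hx, haarFun_of_mem_false hx]
      congr 2
      ring
    have i1 := ih (true :: l) (y + θ l * (k * (m₀ / m)))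
    have i0 := ih (false :: l) (y + θ l * (k * -(m₁ / m)))
    rw [← e1, average_true hS hf h0] at i1
    rw [← e0, average_false hS hf h0] at i0
    have hint := integrable_rpow_add_haarSum (μ := μ) hS hp f θ (N + 1) l y
    have s1 : ∫ x in haarCell S l, |y + haarSum μ S f θ (N + 1) l x| ^ p ∂μ
        = (∫ x in haarCell S (true :: l), |y + haarSum μ S f θ (N + 1) l x| ^ p ∂μ)
        + ∫ x in haarCell S (false :: l), |y + haarSum μ S f θ (N + 1) l x| ^ p ∂μ := by
      rw [← setIntegral_union (disjoint_haarCell S l) (measurableSet_haarCell hS _)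
        hint.integrableOn hint.integrableOn, haarCell_union]
    have s2 : ∫ x in haarCell S l, |f x| ^ p ∂μ
        = (∫ x in haarCell S (true :: l), |f x| ^ p ∂μ)
        + ∫ x in haarCell S (false :: l), |f x| ^ p ∂μ := by
      rw [← setIntegral_union (disjoint_haarCell S l) (measurableSet_haarCell hS _)
        hfp.integrableOn hfp.integrableOn, haarCell_union]
    -- The weights are the relative masses of the children, and the displacements are the values
    -- there of the Haar function times its coefficient.
    have z := hU X y (k * (m₀ / m)) (k * -(m₁ / m)) (m₁ / m) (m₀ / m) (θ l) (by positivity)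
      (by positivity) (by rw [← add_div, ← hmm, div_self h0]) (by ring) (hθ l)
    have z' := mul_le_mul_of_nonneg_left z (measureReal_nonneg (μ := μ) (s := haarCell S l))
    rw [← hm] at z'
    have z2 : m * (m₁ / m * U (X + k * (m₀ / m)) (y + θ l * (k * (m₀ / m))) +
        m₀ / m * U (X + k * -(m₁ / m)) (y + θ l * (k * -(m₁ / m)))) =
        m₁ * U (X + k * (m₀ / m)) (y + θ l * (k * (m₀ / m))) +
        m₀ * U (X + k * -(m₁ / m)) (y + θ l * (k * -(m₁ / m))) := by
      generalize U (X + k * (m₀ / m)) (y + θ l * (k * (m₀ / m))) = A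
      generalize U (X + k * -(m₁ / m)) (y + θ l * (k * -(m₁ / m))) = B
      field_simp
    rw [s1, s2]
    linarith

/-- Reproduction of a function which is constant on each cell of a deep generation. -/
lemma average_add_haarSum [IsFiniteMeasure μ] (hS : ∀ n, MeasurableSet (S n)) {f : α → ℝ}
    (hf : Integrable f μ) (N : ℕ) (l : List Bool)
    (hconst : ∀ v : List Bool, v.length = l.length + N →
      ∃ a : ℝ, ∀ x ∈ haarCell S v, f x = a) :
    ∀ᵐ x ∂μ, x ∈ haarCell S l →
      (⨍ x in haarCell S l, f x ∂μ) + haarSum μ S f (fun _ => 1) N l x = f x := by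
  by_cases h0 : μ (haarCell S l) = 0
  · have : ∀ᵐ x ∂μ, x ∉ haarCell S l := measure_eq_zero_iff_ae_notMem.1 h0
    filter_upwards [this] with x hx hx'
    exact absurd hx' hx
  induction N generalizing l with
  | zero =>
    obtain ⟨a, ha⟩ := hconst l rfl
    have : (⨍ x in haarCell S l, f x ∂μ) = a := by
      rw [setAverage_congr_fun (g := fun _ => a) (measurableSet_haarCell hS l)
        (ae_of_all _ ha), setAverage_const h0 (measure_ne_top _ _)]
    refine ae_of_all _ fun x hx => ?_
    rw [this, ha x hx]
    simp [haarSum, treeSum]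
  | succ N ih =>
    have hl : μ.real (haarCell S l) ≠ 0 := by
      rwa [Ne, measureReal_eq_zero_iff]
    have ih' : ∀ b : Bool, ∀ᵐ x ∂μ, x ∈ haarCell S (b :: l) →
        (⨍ x in haarCell S (b :: l), f x ∂μ) + haarSum μ S f (fun _ => 1) N (b :: l) x = f x := by
      intro b
      by_cases hb : μ (haarCell S (b :: l)) = 0
      · have : ∀ᵐ x ∂μ, x ∉ haarCell S (b :: l) := measure_eq_zero_iff_ae_notMem.1 hb
        filter_upwards [this] with x hx hx'
        exact absurd hx' hx
      · exact ih (b :: l) (fun v hv => hconst v (by rw [hv, List.length_cons]; ring)) hb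
    filter_upwards [ih' true, ih' false] with x h1 h2 hx
    rw [← haarCell_union] at hx
    rcases hx with hx | hx
    · rw [haarSum_succ_of_mem hx, haarFun_of_mem_true hx, ← h1 hx, average_true hS hf hl]
      ring
    · rw [haarSum_succ_of_mem hx, haarFun_of_mem_false hx, ← h2 hx, average_false hS hf hl]
      ring

end Haar

/-! ### The Haar system as an unconditional frame of real L^p. -/

lemma isClosed_setOf_hasSum {𝕜 X ι : Type*} [RCLike 𝕜] [NormedAddCommGroup X] [NormedSpace 𝕜 X]
    (T : ι → X →L[𝕜] X) {K : ℝ} (hK : ∀ (F : Finset ι) x, ‖∑ i ∈ F, T i x‖ ≤ K * ‖x‖) :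
    IsClosed {x | HasSum (fun i => T i x) x} := by
  rw [← closure_subset_iff_isClosed]
  intro x hx
  rw [Set.mem_ofPred_eq, HasSum, Metric.tendsto_nhds]
  intro ε hε
  have hK' : 0 < |K| + 2 := by positivity
  -- The three errors are |K|, 1 and 1 times this tolerance.
  obtain ⟨y, hy, hxy⟩ := Metric.mem_closure_iff.1 hx (ε / (|K| + 2)) (by positivity)
  filter_upwards [(Metric.tendsto_nhds.1 hy) (ε / (|K| + 2)) (by positivity)] with F hF
  rw [dist_eq_norm] at *
  have e : ∑ i ∈ F, T i x - x = ∑ i ∈ F, T i (x - y) + (∑ i ∈ F, T i y - y) - (x - y) := by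
    simp only [map_sub, Finset.sum_sub_distrib]
    abel
  have h1 : ‖∑ i ∈ F, T i (x - y)‖ ≤ |K| * ‖x - y‖ :=
    (hK F _).trans (by gcongr; exact le_abs_self K)
  have h2 : |K| * ‖x - y‖ ≤ |K| * (ε / (|K| + 2)) := by gcongr
  have h3 : |K| * (ε / (|K| + 2)) + ε / (|K| + 2) + ε / (|K| + 2) = ε := by
    field_simp; ring
  rw [e]
  calc _ ≤ ‖∑ i ∈ F, T i (x - y)‖ + ‖∑ i ∈ F, T i y - y‖ + ‖x - y‖ :=
        (norm_sub_le _ _).trans (by gcongr; exact norm_add_le _ _)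
    _ < ε := by linarith

lemma treeSum_congr {M : Type*} [AddCommMonoid M] {a b : List Bool → M} {N : ℕ} {l : List Bool}
    (h : ∀ v, v.length < l.length + N → a v = b v) : treeSum a N l = treeSum b N l := by
  induction N generalizing l with
  | zero => rfl
  | succ N ih =>
    rw [treeSum, treeSum, h l (by omega), ih, ih]
    all_goals
      intro v hv
      apply h
      simp at hv
      omega

section HaarLp

variable {α : Type*} [MeasurableSpace α] {μ : Measure α} [IsFiniteMeasure μ]
  {p : ℝ≥0∞} [Fact (1 ≤ p)]

/-- The functional `f ↦ ⨍ x in s, f x ∂μ` on `L^p` of a finite measure. -/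
lemma exists_setAverage_functional (s : Set α) :
    ∃ φ : StrongDual ℝ (Lp ℝ p μ), ∀ f, φ f = ⨍ x in s, f x ∂μ := by
  have hint : ∀ f : Lp ℝ p μ, Integrable f μ := fun f => (Lp.memLp f).integrable Fact.out
  let L : Lp ℝ p μ →ₗ[ℝ] ℝ :=
    { toFun := fun f => ⨍ x in s, f x ∂μ
      map_add' := fun f g => by
        rw [setAverage_eq, setAverage_eq, setAverage_eq, ← smul_add,
          ← integral_add (hint f).integrableOn (hint g).integrableOn]
        congr 1
        exact integral_congr_ae (ae_restrict_of_ae (Lp.coeFn_add f g))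
      map_smul' := fun c f => by
        rw [setAverage_eq, setAverage_eq, RingHom.id_apply,
          integral_congr_ae (ae_restrict_of_ae (Lp.coeFn_smul c f))]
        simp only [Pi.smul_apply, integral_smul]
        rw [smul_comm] }
  -- The bound is the embedding constant of L^p into L^1 on a finite measure space, divided by the
  -- mass of s.
  refine ⟨L.mkContinuousOfExistsBound ⟨(μ.real s)⁻¹ *
    (μ Set.univ ^ (1 / (1 : ℝ≥0∞).toReal - 1 / p.toReal)).toReal, fun f => ?_⟩, fun f => rfl⟩
  change ‖⨍ x in s, f x ∂μ‖ ≤ _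
  rw [setAverage_eq, norm_smul, Real.norm_of_nonneg (by positivity), mul_assoc]
  refine mul_le_mul_of_nonneg_left ?_ (by positivity)
  calc ‖∫ x in s, f x ∂μ‖ ≤ ∫ x in s, ‖f x‖ ∂μ := norm_integral_le_integral_norm _
    _ ≤ ∫ x, ‖f x‖ ∂μ := setIntegral_le_integral (hint f).norm (ae_of_all _ fun x => norm_nonneg _)
    _ = (eLpNorm f 1 μ).toReal := by
      rw [integral_norm_eq_lintegral_enorm (hint f).1, eLpNorm_one_eq_lintegral_enorm]
    _ ≤ (eLpNorm f p μ * μ Set.univ ^ (1 / (1 : ℝ≥0∞).toReal - 1 / p.toReal)).toReal := by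
      refine ENNReal.toReal_mono (ENNReal.mul_ne_top (Lp.eLpNorm_ne_top f) ?_)
        (eLpNorm_le_eLpNorm_mul_rpow_measure_univ Fact.out (Lp.aestronglyMeasurable f))
      refine ENNReal.rpow_ne_top_of_nonneg ?_ (measure_ne_top _ _)
      have h1 : (1 : ℝ≥0∞) ≤ p := Fact.out
      by_cases hp : p = ⊤
      · simp [hp]
      · have : 1 ≤ p.toReal := by
          simpa using ENNReal.toReal_mono hp h1
        rw [sub_nonneg, ENNReal.toReal_one]
        exact one_div_le_one_div_of_le one_pos this
    _ = _ := by rw [ENNReal.toReal_mul, mul_comm, Lp.norm_def]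

/-- The averaging functionals over sets. -/
noncomputable def averageFunctional (μ : Measure α) [IsFiniteMeasure μ] (p : ℝ≥0∞)
    [Fact (1 ≤ p)] (s : Set α) : StrongDual ℝ (Lp ℝ p μ) :=
  (exists_setAverage_functional s).choose

lemma averageFunctional_apply (s : Set α) (f : Lp ℝ p μ) :
    averageFunctional μ p s f = ⨍ x in s, f x ∂μ :=
  (exists_setAverage_functional s).choose_spec f

/-- The Haar system, indexed by the cells, with the constant function `1` added. -/
noncomputable def haarSystem (μ : Measure α) (S : ℕ → Set α) : Option (List Bool) → α → ℝ
  | none => fun _ => 1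
  | some l => haarFun μ S l

/-- The coefficient functionals of the Haar system. -/
noncomputable def haarDual (μ : Measure α) [IsFiniteMeasure μ] (p : ℝ≥0∞)
    [Fact (1 ≤ p)] (S : ℕ → Set α) : Option (List Bool) → StrongDual ℝ (Lp ℝ p μ)
  | none => averageFunctional μ p Set.univ
  | some l => averageFunctional μ p (haarCell S (true :: l)) -
      averageFunctional μ p (haarCell S (false :: l))

lemma haarDual_some (S : ℕ → Set α) (l : List Bool) (f : Lp ℝ p μ) :
    haarDual μ p S (some l) f = haarCoef μ S f l := by
  rw [haarDual, sub_apply, averageFunctional_apply, averageFunctional_apply,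
    haarCoef]

variable {S : ℕ → Set α}

lemma abs_haarSystem_le (i : Option (List Bool)) (x : α) : |haarSystem μ S i x| ≤ 1 := by
  cases i
  · simp [haarSystem]
  · exact abs_haarFun_le _ _

lemma measurable_haarSystem {μ : Measure α} (hS : ∀ n, MeasurableSet (S n)) (i : Option (List Bool)) :
    Measurable (haarSystem μ S i) := by
  cases i
  · exact measurable_const
  · exact measurable_haarFun hS _

lemma finite_range_haarSystem {μ : Measure α} (i : Option (List Bool)) :
    (Set.range (haarSystem μ S i)).Finite := by
  cases i
  · exact (Set.finite_singleton (1 : ℝ)).subset (by rintro _ ⟨x, rfl⟩; rfl)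
  · exact finite_range_haarFun _

open Classical in
-- Membership in `F` becomes the multiplier: an arbitrary partial sum is a martingale transform,
-- started at the mean of f or at 0.
lemma haar_partialSum {u : Option (List Bool) → Lp ℝ p μ} (hu : ∀ i, u i =ᵐ[μ] haarSystem μ S i)
    (f : Lp ℝ p μ) (F : Finset (Option (List Bool))) {N : ℕ}
    (hN : ∀ l, some l ∈ F → l.length < N) :
    ∀ᵐ x ∂μ, (∑ i ∈ F, haarDual μ p S i f • u i : Lp ℝ p μ) x =
      (if none ∈ F then ⨍ x, f x ∂μ else 0) +
        haarSum μ S f (fun l => if some l ∈ F then 1 else 0) N [] x := by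
  have h1 := Lp.coeFn_fun_finsetSum F (fun i => haarDual μ p S i f • u i)
  have h2 : ∀ᵐ x ∂μ, ∀ i, (haarDual μ p S i f • u i : Lp ℝ p μ) x =
      haarDual μ p S i f * haarSystem μ S i x := by
    rw [ae_all_iff]
    intro i
    filter_upwards [Lp.coeFn_smul (haarDual μ p S i f) (u i), hu i] with x hx hx'
    rw [hx, Pi.smul_apply, hx', smul_eq_mul]
  filter_upwards [h1, h2] with x hx hx'
  rw [hx]
  simp_rw [hx']
  rw [haarSum, treeSum_nil_eq_sum (F := Finset.eraseNone F) (by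
      intro l hl
      rw [Finset.mem_eraseNone] at hl
      simp [hl]) (by
      intro l hl
      exact hN l (Finset.mem_eraseNone.1 hl)), Finset.sum_apply,
    Finset.sum_eraseNone]
  have e : ∀ i : Option (List Bool), i ∈ F → haarDual μ p S i f * haarSystem μ S i x =
      (if i = none then (haarDual μ p S i f * haarSystem μ S i x) else 0) +
      Option.elim' 0 (fun v => (((if some v ∈ F then (1 : ℝ) else 0) * haarCoef μ S f v) •
        haarFun μ S v) x) i := by
    intro i hi
    cases i with
    | none => simp
    | some l => simp [hi, haarDual_some, haarSystem]
  rw [Finset.sum_congr rfl e, Finset.sum_add_distrib, Finset.sum_ite_eq']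
  simp [haarSystem, haarDual, averageFunctional_apply]

/-- The starting value y is the mean of f or 0, so U(mean, y) ≤ 0 and `haarSum_burkholder` leaves
c‖sum‖^p ≤ C‖f‖^p. The constant is independent of `F`, which is what makes the convergence
unconditional. -/
lemma haar_partialSum_bound (hp : 1 < p) (hp' : p < ⊤) (hS : ∀ n, MeasurableSet (S n))
    {u : Option (List Bool) → Lp ℝ p μ} (hu : ∀ i, u i =ᵐ[μ] haarSystem μ S i) :
    ∃ K : ℝ, ∀ (F : Finset (Option (List Bool))) (f : Lp ℝ p μ),
      ‖∑ i ∈ F, haarDual μ p S i f • u i‖ ≤ K * ‖f‖ := by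
  classical
  have hpr : 1 < p.toReal := by
    simpa using (ENNReal.toReal_lt_toReal ENNReal.one_ne_top hp'.ne).2 hp
  have hp0 : p ≠ 0 := (zero_lt_one.trans hp).ne'
  have hpos : 0 < p.toReal := by linarith
  obtain ⟨U, c, C, hc, hC, hU, hUneg, hUlow⟩ := exists_burkholder_function hpr
  have hnorm : ∀ g : Lp ℝ p μ, ‖g‖ ^ p.toReal = ∫ x, |g x| ^ p.toReal ∂μ := by
    intro g
    rw [Lp.norm_def, (Lp.memLp g).eLpNorm_eq_integral_rpow_norm hp0 hp'.ne,
      ENNReal.toReal_ofReal (by positivity), Real.rpow_inv_rpow (by positivity) hpos.ne']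
    rfl
  refine ⟨(C / c) ^ p.toReal⁻¹, fun F f => ?_⟩
  have hf : Integrable f μ := (Lp.memLp f).integrable Fact.out
  have hfp : Integrable (fun x => |f x| ^ p.toReal) μ := (Lp.memLp f).integrable_norm_rpow hp0 hp'.ne
  obtain ⟨N, hN⟩ : ∃ N : ℕ, ∀ l, some l ∈ F → l.length < N := by
    refine ⟨(Finset.eraseNone F).sup List.length + 1, fun l hl => Nat.lt_succ_of_le ?_⟩
    exact Finset.le_sup (f := List.length) (Finset.mem_eraseNone.2 hl)
  have h1 := haar_partialSum hu f F hN
  set y : ℝ := if none ∈ F then ⨍ x, f x ∂μ else 0 with hy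
  have hy' : |y| ≤ |⨍ x, f x ∂μ| := by
    rw [hy]; split_ifs
    · exact le_rfl
    · simp
  have h2 := haarSum_burkholder hS hpr hC hU hUlow hf hfp
    (θ := fun l => if some l ∈ F then 1 else 0) (fun l => by split_ifs <;> simp) N [] y
  simp only [haarCell, Measure.restrict_univ] at h2
  have h3 : c * ‖∑ i ∈ F, haarDual μ p S i f • u i‖ ^ p.toReal ≤ C * ‖f‖ ^ p.toReal := by
    rw [hnorm, hnorm]
    have e : ∫ x, |(∑ i ∈ F, haarDual μ p S i f • u i : Lp ℝ p μ) x| ^ p.toReal ∂μ =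
        ∫ x, |y + haarSum μ S f (fun l => if some l ∈ F then 1 else 0) N [] x| ^ p.toReal ∂μ := by
      apply integral_congr_ae
      filter_upwards [h1] with x hx
      rw [hx]
    rw [e]
    refine h2.trans ?_
    have := mul_nonpos_of_nonneg_of_nonpos (measureReal_nonneg (μ := μ) (s := Set.univ))
      (hUneg _ _ hy')
    linarith
  have h4 : ‖∑ i ∈ F, haarDual μ p S i f • u i‖ ^ p.toReal ≤
      ((C / c) ^ p.toReal⁻¹ * ‖f‖) ^ p.toReal := by
    rw [Real.mul_rpow (by positivity) (norm_nonneg _), Real.rpow_inv_rpow (by positivity) hpos.ne',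
      div_mul_eq_mul_div, le_div_iff₀ hc]
    linarith
  exact (Real.rpow_le_rpow_iff (norm_nonneg _) (by positivity) hpos).1 h4

/-- The function is constant on every cell of generation beyond n, so the expansion stops there and
reproduces it. -/
lemma haar_hasSum_indicator (hS : ∀ n, MeasurableSet (S n))
    {u : Option (List Bool) → Lp ℝ p μ} (hu : ∀ i, u i =ᵐ[μ] haarSystem μ S i) (n : ℕ) (a : ℝ)
    (f : Lp ℝ p μ) (hf : f =ᵐ[μ] (S n).indicator fun _ => a) :
    HasSum (fun i => haarDual μ p S i f • u i) f := by
  classical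
  set f₀ : α → ℝ := (S n).indicator fun _ => a with hf₀
  have hint : Integrable f₀ μ := (integrable_const a).indicator (hS n)
  have hconst : ∀ v : List Bool, n < v.length → ∃ b : ℝ, ∀ x ∈ haarCell S v, f₀ x = b := by
    intro v hv
    rcases haarCell_subset_or_disjoint S n v hv with h | h
    · exact ⟨a, fun x hx => Set.indicator_of_mem (h hx) _⟩
    · exact ⟨0, fun x hx => Set.indicator_of_notMem (Set.disjoint_left.1 h hx) _⟩
  have havg : ∀ s, (⨍ x in s, f x ∂μ) = ⨍ x in s, f₀ x ∂μ := fun s => by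
    rw [setAverage_eq, setAverage_eq, integral_congr_ae (ae_restrict_of_ae hf)]
  have hcoef : haarCoef μ S f = haarCoef μ S f₀ := by
    funext l
    rw [haarCoef, haarCoef, havg, havg]
  let F : Finset (Option (List Bool)) :=
    Finset.insertNone (List.finite_length_le Bool n).toFinset
  have hF : ∀ l, some l ∈ F ↔ l.length ≤ n := by
    intro l
    simp [F]
  have hsum : ∑ i ∈ F, haarDual μ p S i f • u i = f := by
    apply Lp.ext
    have h1 := haar_partialSum (S := S) hu f F (N := n + 1)
      (fun l hl => Nat.lt_succ_of_le ((hF l).1 hl))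
    have h2 := average_add_haarSum (μ := μ) hS hint (n + 1) [] (fun v hv => hconst v (by
      rw [hv]; simp))
    filter_upwards [h1, h2, hf] with x h1 h2 h3
    rw [h1, h3, ← h2 (Set.mem_univ x), if_pos (by simp [F])]
    have e := havg Set.univ
    rw [Measure.restrict_univ] at e
    simp only [haarCell, Measure.restrict_univ]
    rw [e]
    congr 1
    unfold haarSum
    refine congrFun (treeSum_congr fun v hv => ?_) x
    have hm : some v ∈ F := (hF v).2 (by simp at hv; omega)
    simp only [hm, if_true, hcoef]
  have hz : ∀ i ∉ F, haarDual μ p S i f • u i = 0 := by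
    intro i hi
    cases i with
    | none => exact absurd (by simp [F]) hi
    | some l =>
      rw [hF] at hi
      push Not at hi
      apply Lp.ext
      -- The reproductions at depths 1 and 0 differ by exactly one Haar term, which therefore
      -- vanishes almost everywhere.
      have h1 := average_add_haarSum (μ := μ) hS hint 1 l
        (fun v hv => hconst v (by omega))
      have h2 := average_add_haarSum (μ := μ) hS hint 0 l
        (fun v hv => hconst v (by omega))
      filter_upwards [h1, h2, Lp.coeFn_smul (haarDual μ p S (some l) f) (u (some l)), hu (some l),
        Lp.coeFn_zero ℝ p μ] with x h1 h2 h3 h4 h5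
      rw [h3, h5, Pi.smul_apply, h4, haarDual_some, hcoef, smul_eq_mul, haarSystem, Pi.zero_apply]
      by_cases hx : x ∈ haarCell S l
      · have h1 := h1 hx
        have h2 := h2 hx
        simp [haarSum, treeSum] at h1 h2
        have : haarCoef μ S f₀ l * haarFun μ S l x = 0 := by linarith
        exact this
      · rw [haarFun_of_notMem hx, mul_zero]
  have h : HasSum (fun i => haarDual μ p S i f • u i) (∑ i ∈ F, haarDual μ p S i f • u i) :=
    hasSum_sum_of_ne_finset_zero hz
  rw [hsum] at h
  exact h

/-- The Haar system of a measure-dense sequence of sets is an unconditional Schauder frame. -/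
theorem exists_haar_frame (hp : 1 < p) (hp' : p < ⊤) [IsSeparable μ] :
    ∃ (h : Option (List Bool) → α → ℝ) (u : Option (List Bool) → Lp ℝ p μ)
      (u' : Option (List Bool) → StrongDual ℝ (Lp ℝ p μ)),
      (∀ i, Measurable (h i) ∧ (Set.range (h i)).Finite ∧ ∀ x, |h i x| ≤ 1) ∧
      (∀ i, u i =ᵐ[μ] h i) ∧ ∀ f, HasSum (fun i => u' i f • u i) f := by
  obtain ⟨𝒜, hcount, hdense⟩ := exists_countable_measureDense μ
  obtain ⟨S, hS⟩ := hcount.exists_eq_range hdense.nonempty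
  subst hS
  have hSm : ∀ n, MeasurableSet (S n) := fun n => hdense.measurable _ ⟨n, rfl⟩
  have hmem : ∀ i, MemLp (haarSystem μ S i) p μ := fun i =>
    MemLp.of_bound (measurable_haarSystem hSm i).aestronglyMeasurable 1
      (ae_of_all _ fun x => abs_haarSystem_le i x)
  have hu : ∀ i, (hmem i).toLp =ᵐ[μ] haarSystem μ S i := fun i => (hmem i).coeFn_toLp
  refine ⟨haarSystem μ S, fun i => (hmem i).toLp, haarDual μ p S, fun i =>
    ⟨measurable_haarSystem hSm i, finite_range_haarSystem i, abs_haarSystem_le i⟩, hu, ?_⟩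
  obtain ⟨K, hK⟩ := haar_partialSum_bound hp hp' hSm hu
  let T : Option (List Bool) → Lp ℝ p μ →L[ℝ] Lp ℝ p μ := fun i =>
    (haarDual μ p S i).smulRight (hmem i).toLp
  have hcl := isClosed_setOf_hasSum T (K := K) (fun F f => by simpa [T] using hK F f)
  have : Fact (p ≠ ⊤) := ⟨hp'.ne⟩
  intro f
  refine Lp.induction hp'.ne (motive := fun f => HasSum (fun i => T i f) f) ?_ ?_ hcl f
  · intro c s hs hμs
    rw [Lp.simpleFunc.coe_indicatorConst]
    -- Measure density puts every multiple of an indicator in the closure of the same multiples of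
    -- indicators of the `S n`; the set of good f is closed.
    have h1 := hdense.indicatorConstLp_subset_closure p c ⟨s, hs, hμs.ne, rfl⟩
    refine hcl.closure_subset_iff.2 ?_ h1
    rintro _ ⟨_, ⟨n, rfl⟩, hn', rfl⟩
    exact haar_hasSum_indicator hSm hu n c _ indicatorConstLp_coeFn
  · intro f g hf hg _ h1 h2
    have := h1.add h2
    simpa only [map_add] using this

end HaarLp

/-! ### Splitting the vectors of a frame into averages. -/

section Splitting

variable {𝕜 X : Type*} [RCLike 𝕜] [NormedAddCommGroup X] [NormedSpace 𝕜 X] {ι : Type*}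

/-- A sum with weights in [0, 1] is a convex combination of subset sums. The offset a absorbs the
terms already decided in the induction. -/
lemma norm_sum_smul_le_of_subset_sums (f : ι → X) {w : ι → ℝ} (hw : ∀ i, 0 ≤ w i ∧ w i ≤ 1)
    (s : Finset ι) {M : ℝ} (a : X) (h : ∀ t ⊆ s, ‖a + ∑ i ∈ t, f i‖ ≤ M) :
    ‖a + ∑ i ∈ s, (w i : 𝕜) • f i‖ ≤ M := by
  classical
  induction s using Finset.induction_on generalizing a with
  | empty => simpa using h ∅ le_rfl
  | insert i s hi ih =>
    have h1 := ih (a + f i) (fun t ht => by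
      have := h (insert i t) (Finset.insert_subset_insert i ht)
      rwa [Finset.sum_insert (fun h => hi (ht h)), ← add_assoc] at this)
    have h2 := ih a (fun t ht => h t (ht.trans (Finset.subset_insert i s)))
    rw [Finset.sum_insert hi]
    have e : a + ((w i : 𝕜) • f i + ∑ j ∈ s, (w j : 𝕜) • f j) =
        (w i : 𝕜) • (a + f i + ∑ j ∈ s, (w j : 𝕜) • f j) +
        ((1 - w i : ℝ) : 𝕜) • (a + ∑ j ∈ s, (w j : 𝕜) • f j) := by
      push_cast
      module
    rw [e]
    refine (norm_add_le _ _).trans ?_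
    rw [norm_smul, norm_smul, RCLike.norm_ofReal, RCLike.norm_ofReal, abs_of_nonneg (hw i).1,
      abs_of_nonneg (sub_nonneg.2 (hw i).2)]
    have h3 := mul_le_mul_of_nonneg_left h1 (hw i).1
    have h4 := mul_le_mul_of_nonneg_left h2 (sub_nonneg.2 (hw i).2)
    linarith

lemma sum_sigma_finset_eq {M : Type*} [AddCommMonoid M] {N : ι → ℕ} [DecidableEq ι]
    (t : Finset (Σ i, Fin (N i))) (φ : (Σ i, Fin (N i)) → M) :
    ∑ q ∈ t, φ q = ∑ i ∈ t.image Sigma.fst,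
      ∑ j ∈ Finset.univ.filter (fun j => (⟨i, j⟩ : Σ i, Fin (N i)) ∈ t), φ ⟨i, j⟩ := by
  rw [← Finset.sum_sigma (t.image Sigma.fst)
    (fun i => Finset.univ.filter (fun j => (⟨i, j⟩ : Σ i, Fin (N i)) ∈ t)) φ]
  congr 1
  ext ⟨i, j⟩
  simp only [Finset.mem_sigma, Finset.mem_image, Finset.mem_filter, Finset.mem_univ, true_and]
  exact ⟨fun h => ⟨⟨_, h, rfl⟩, h⟩, fun h => h.2⟩

lemma disjoint_image_fst {N : ι → ℕ} [DecidableEq ι] {s : Finset ι}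
    {t : Finset (Σ i, Fin (N i))} (h : Disjoint t (s.sigma fun _ => Finset.univ)) :
    Disjoint (t.image Sigma.fst) s := by
  rw [Finset.disjoint_left] at *
  intro i hi hs
  obtain ⟨q, hq, rfl⟩ := Finset.mem_image.1 hi
  exact h hq (Finset.mem_sigma.2 ⟨hs, Finset.mem_univ _⟩)

variable [CompleteSpace X]

/-- A finite set of pieces takes from each term a fraction in [0, 1], so its sum is controlled by
subset sums of the original series. -/
lemma summable_split (N : ι → ℕ) {f : ι → X} (hf : Summable f) :
    Summable (fun q : Σ i, Fin (N i) => (N q.1 : 𝕜)⁻¹ • f q.1) := by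
  classical
  rw [summable_iff_vanishing_norm] at *
  intro ε hε
  obtain ⟨s, hs⟩ := hf (ε / 2) (by positivity)
  refine ⟨s.sigma fun _ => Finset.univ, fun t ht => ?_⟩
  have hd := disjoint_image_fst ht
  rw [sum_sigma_finset_eq]
  set J := fun i => Finset.univ.filter (fun j => (⟨i, j⟩ : Σ i, Fin (N i)) ∈ t) with hJ
  have e : ∀ i, ∑ j ∈ J i, (N i : 𝕜)⁻¹ • f i = (((J i).card / N i : ℝ) : 𝕜) • f i := by
    intro i
    rw [Finset.sum_const, ← Nat.cast_smul_eq_nsmul 𝕜, smul_smul]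
    push_cast
    rw [div_eq_mul_inv]
  change ‖∑ i ∈ t.image Sigma.fst, ∑ j ∈ J i, (N i : 𝕜)⁻¹ • f i‖ < ε
  simp_rw [e]
  have h := norm_sum_smul_le_of_subset_sums (𝕜 := 𝕜) f (w := fun i => (J i).card / N i)
    (fun i => ⟨by positivity, div_le_one_of_le₀ (by
      have := (J i).card_le_univ
      rw [Fintype.card_fin] at this
      exact_mod_cast this) (by positivity)⟩) (t.image Sigma.fst) (M := ε / 2) 0 (fun t' ht' => by
      rw [zero_add]
      exact (hs t' (hd.mono_left ht')).le)
  rw [zero_add] at h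
  linarith

lemma summable_of_fiber_bound {N : ι → ℕ} {φ : (Σ i, Fin (N i)) → X} {b : ι → ℝ}
    (hb : Summable b) (h : ∀ i (J : Finset (Fin (N i))), ‖∑ j ∈ J, φ ⟨i, j⟩‖ ≤ b i) :
    Summable φ := by
  classical
  rw [summable_iff_vanishing_norm] at *
  intro ε hε
  obtain ⟨s, hs⟩ := hb ε hε
  refine ⟨s.sigma fun _ => Finset.univ, fun t ht => ?_⟩
  rw [sum_sigma_finset_eq]
  refine (norm_sum_le _ _).trans_lt ?_
  refine (Finset.sum_le_sum fun i _ => h i _).trans_lt ?_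
  exact (le_abs_self _).trans_lt (hs _ (disjoint_image_fst ht))

/-- If each vector of an unconditional frame is split into an average, up to a small error which
is uniform over all partial averages, then the pieces form an unconditional frame. -/
theorem exists_frame_of_splitting {u : ι → X} {u' : ι → StrongDual 𝕜 X}
    (hu : ∀ x, HasSum (fun i => u' i x • u i) x) {N : ι → ℕ} (hN : ∀ i, 0 < N i)
    {g : (Σ i, Fin (N i)) → X} {ε : ι → ℝ} (hε : Summable fun i => ‖u' i‖ * ε i)
    (hlt : ∑' i, ‖u' i‖ * ε i < 1)
    (hg : ∀ i (J : Finset (Fin (N i))), ‖∑ j ∈ J, (N i : 𝕜)⁻¹ • (g ⟨i, j⟩ - u i)‖ ≤ ε i) :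
    ∃ g' : (Σ i, Fin (N i)) → StrongDual 𝕜 X, ∀ x, HasSum (fun q => g' q x • g q) x := by
  set d : ι → X := fun i => ∑ j : Fin (N i), (N i : 𝕜)⁻¹ • (g ⟨i, j⟩ - u i) with hd
  have hdn : ∀ i, ‖(u' i).smulRight (d i)‖ ≤ ‖u' i‖ * ε i := fun i => by
    rw [ContinuousLinearMap.norm_smulRight_apply]
    exact mul_le_mul_of_nonneg_left (hg i Finset.univ) (norm_nonneg _)
  have hsum : Summable fun i => (u' i).smulRight (d i) := Summable.of_norm_bounded hε hdn
  -- R collects the deviations of the full averages from the u i; the split series sums to x + R x.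
  set R : X →L[𝕜] X := ∑' i, (u' i).smulRight (d i) with hR
  have hRn : ‖R‖ < 1 := (tsum_of_norm_bounded hε.hasSum hdn).trans_lt hlt
  have hRx : ∀ x, HasSum (fun i => u' i x • d i) (R x) := fun x =>
    hsum.hasSum.mapL (ContinuousLinearMap.apply 𝕜 X x)
  have key : ∀ x, HasSum (fun q : Σ i, Fin (N i) => ((N q.1 : 𝕜)⁻¹ * u' q.1 x) • g q)
      (x + R x) := by
    intro x
    have hN0 : ∀ i, (N i : 𝕜) ≠ 0 := fun i => Nat.cast_ne_zero.2 (hN i).ne'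
    have s1 := summable_split (𝕜 := 𝕜) N (hu x).summable
    have s2 : Summable (fun q : Σ i, Fin (N i) => u' q.1 x • (N q.1 : 𝕜)⁻¹ • (g q - u q.1)) := by
      refine summable_of_fiber_bound (b := fun i => ‖x‖ * (‖u' i‖ * ε i)) (hε.mul_left _) ?_
      intro i J
      change ‖∑ j ∈ J, u' i x • (N i : 𝕜)⁻¹ • (g ⟨i, j⟩ - u i)‖ ≤ _
      rw [← Finset.smul_sum, norm_smul]
      calc _ ≤ (‖u' i‖ * ‖x‖) * ε i :=
            mul_le_mul ((u' i).le_opNorm x) (hg i J) (norm_nonneg _) (by positivity)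
        _ = _ := by ring
    have t1 : ∑' q : Σ i, Fin (N i), (N q.1 : 𝕜)⁻¹ • (u' q.1 x • u q.1) = x := by
      have := s1.hasSum.sigma (fun i => hasSum_fintype _)
      refine this.unique ?_
      convert hu x using 2 with i
      change ∑ _j : Fin (N i), (N i : 𝕜)⁻¹ • u' i x • u i = _
      rw [Finset.sum_const, Finset.card_univ, Fintype.card_fin, ← Nat.cast_smul_eq_nsmul 𝕜,
        smul_smul, mul_inv_cancel₀ (hN0 i), one_smul]
    have t2 : ∑' q : Σ i, Fin (N i), u' q.1 x • (N q.1 : 𝕜)⁻¹ • (g q - u q.1) = R x := by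
      have := s2.hasSum.sigma (fun i => hasSum_fintype _)
      refine this.unique ?_
      convert hRx x using 2 with i
      rw [hd, Finset.smul_sum]
    have := s1.hasSum.add s2.hasSum
    rw [t1, t2] at this
    convert this using 2 with q
    module
  have hRn' : ‖-R‖ < 1 := by rwa [norm_neg]
  -- T = 1 + R is inverted by a Neumann series; the key identity is then applied at T⁻¹ x.
  set T := Units.oneSub (-R) hRn' with hT
  have hTv : (T : X →L[𝕜] X) = 1 + R := by
    rw [hT, Units.val_oneSub, sub_neg_eq_add]
  refine ⟨fun q => (N q.1 : 𝕜)⁻¹ • (u' q.1).comp (T⁻¹ : (X →L[𝕜] X)ˣ).val, fun x => ?_⟩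
  have := key ((T⁻¹ : (X →L[𝕜] X)ˣ).val x)
  have e : (T⁻¹ : (X →L[𝕜] X)ˣ).val x + R ((T⁻¹ : (X →L[𝕜] X)ˣ).val x) = x := by
    have h1 : (T : X →L[𝕜] X) * (T⁻¹ : (X →L[𝕜] X)ˣ).val = 1 := T.mul_inv
    have h2 := congrArg (fun L : X →L[𝕜] X => L x) h1
    rw [hTv] at h2
    exact h2
  rw [e] at this
  exact this

omit [CompleteSpace X] in
lemma isUnconditionalSchauderFrame_of_hasSum {g : ℕ → X} {g' : ℕ → StrongDual 𝕜 X}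
    (h : ∀ x, HasSum (fun n => g' n x • g n) x) : IsUnconditionalSchauderFrame 𝕜 g g' :=
  ⟨fun x => (h x).tendsto_sum_nat,
    fun x σ => ((Equiv.hasSum_iff σ).2 (h x)).tendsto_sum_nat⟩

/-- If the vectors of an unconditional frame are limits of averages of elements of `G`, uniformly
over partial averages, then there is an unconditional frame with vectors in `G`. -/
theorem exists_frame_mem_of_averages [Countable ι] [Infinite ι] {u : ι → X}
    {u' : ι → StrongDual 𝕜 X} (hu : ∀ x, HasSum (fun i => u' i x • u i) x) (G : Set X)
    (hG : ∀ i, ∀ ε : ℝ, 0 < ε → ∃ (N : ℕ) (g : Fin N → X), 0 < N ∧ (∀ j, g j ∈ G) ∧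
      ∀ J : Finset (Fin N), ‖∑ j ∈ J, (N : 𝕜)⁻¹ • (g j - u i)‖ ≤ ε) :
    ∃ (g : ℕ → X) (g' : ℕ → StrongDual 𝕜 X),
      (∀ x, HasSum (fun n => g' n x • g n) x) ∧ ∀ n, g n ∈ G := by
  obtain ⟨_⟩ := nonempty_encodable ι
  obtain ⟨δ, hδ, c, hc, hc1⟩ := posSumOfEncodable (ε := 1 / 2) (by norm_num) ι
  -- With these tolerances the perturbation has norm at most ∑ δ i ≤ 1/2; the added 1 avoids
  -- dividing by zero.
  have hpos : ∀ i, 0 < δ i / (‖u' i‖ + 1) := fun i => div_pos (hδ i) (by positivity)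
  choose N g hN hgG hg using fun i => hG i _ (hpos i)
  have hle : ∀ i, ‖u' i‖ * (δ i / (‖u' i‖ + 1)) ≤ δ i := by
    intro i
    rw [mul_div_assoc', div_le_iff₀ (by positivity)]
    nlinarith [hδ i, norm_nonneg (u' i)]
  have hs : Summable fun i => ‖u' i‖ * (δ i / (‖u' i‖ + 1)) :=
    Summable.of_nonneg_of_le (fun i => mul_nonneg (norm_nonneg _) (hpos i).le) hle hc.summable
  have hlt : ∑' i, ‖u' i‖ * (δ i / (‖u' i‖ + 1)) < 1 := by
    have := hs.tsum_le_tsum hle hc.summable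
    rw [hc.tsum_eq] at this
    linarith
  obtain ⟨g', hg'⟩ := exists_frame_of_splitting hu hN (g := fun q => g q.1 q.2) hs hlt hg
  have : Infinite (Σ i, Fin (N i)) :=
    Infinite.of_injective (fun i => (⟨i, ⟨0, hN i⟩⟩ : Σ i, Fin (N i)))
      (fun i j h => congrArg Sigma.fst h)
  obtain ⟨_⟩ := nonempty_denumerable (Σ i, Fin (N i))
  let e : ℕ ≃ (Σ i, Fin (N i)) := (Denumerable.eqv _).symm
  exact ⟨fun n => g (e n).1 (e n).2, fun n => g' (e n), fun x => (Equiv.hasSum_iff e).2 (hg' x),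
    fun n => hgG _ _⟩

end Splitting

/-! ### Small averages from almost orthogonality; complexification. -/

section Averages

variable {α 𝕜 : Type*} [MeasurableSpace α] [RCLike 𝕜] {μ : Measure α} [IsFiniteMeasure μ]

/-- Uniformly bounded functions which are small in `L^2` are small in `L^p`. -/
lemma exists_eLpNorm_le_of_integral_sq_le (μ : Measure α) [IsFiniteMeasure μ] {p : ℝ≥0∞}
    (hp0 : p ≠ 0) (hp' : p ≠ ⊤) {ε : ℝ} (hε : 0 < ε) : ∃ η : ℝ, 0 < η ∧
      ∀ h : α → 𝕜, AEStronglyMeasurable h μ → (∀ x, ‖h x‖ ≤ 2) → ∫ x, ‖h x‖ ^ 2 ∂μ ≤ η →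
        eLpNorm h p μ ≤ ENNReal.ofReal ε := by
  set q := p.toReal with hq
  have hq0 : 0 < q := ENNReal.toReal_pos hp0 hp'
  set m := μ.real Set.univ with hm
  have hm0 : 0 ≤ m := measureReal_nonneg
  -- The level s gives μ(univ) s^q ≤ ε^q / 2, which controls the part where ‖h‖ ≤ s. Where ‖h‖ > s,
  -- the bound ‖h‖ ≤ 2 gives ‖h‖^q ≤ 2^q ‖h‖² / s², and η makes that part at most ε^q / 2.
  set s := ε * (2 * (m + 1)) ^ (-q⁻¹) with hs
  have hs0 : 0 < s := by positivity
  have hsq : s ^ q = ε ^ q / (2 * (m + 1)) := by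
    rw [hs, Real.mul_rpow hε.le (by positivity), ← Real.rpow_mul (by positivity),
      neg_mul, inv_mul_cancel₀ hq0.ne', Real.rpow_neg_one, div_eq_mul_inv]
  refine ⟨ε ^ q / 2 * (s ^ 2 / 2 ^ q), by positivity, fun h hh hb hη => ?_⟩
  have hmem : MemLp h p μ := MemLp.of_bound hh 2 (ae_of_all _ hb)
  rw [hmem.eLpNorm_eq_integral_rpow_norm hp0 hp']
  apply ENNReal.ofReal_le_ofReal
  rw [← hq]
  have hsqint : Integrable (fun x => ‖h x‖ ^ 2) μ :=
    Integrable.of_bound (hh.norm.pow 2) 4 (ae_of_all _ fun x => by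
      rw [Real.norm_of_nonneg (by positivity)]
      nlinarith [hb x, norm_nonneg (h x)])
  have hpt : ∀ x, ‖h x‖ ^ q ≤ s ^ q + 2 ^ q / s ^ 2 * ‖h x‖ ^ 2 := by
    intro x
    by_cases hx : ‖h x‖ ≤ s
    · have := Real.rpow_le_rpow (norm_nonneg _) hx hq0.le
      have : 0 ≤ 2 ^ q / s ^ 2 * ‖h x‖ ^ 2 := by positivity
      linarith
    · push Not at hx
      have h1 := Real.rpow_le_rpow (norm_nonneg _) (hb x) hq0.le
      have h2 : 1 ≤ ‖h x‖ ^ 2 / s ^ 2 := by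
        rw [one_le_div (by positivity)]
        gcongr
      have h3 : (2 : ℝ) ^ q ≤ 2 ^ q * (‖h x‖ ^ 2 / s ^ 2) :=
        le_mul_of_one_le_right (by positivity) h2
      have h4 : 0 ≤ s ^ q := by positivity
      have h5 : (2 : ℝ) ^ q / s ^ 2 * ‖h x‖ ^ 2 = 2 ^ q * (‖h x‖ ^ 2 / s ^ 2) := by ring
      linarith
  have hI : ∫ x, ‖h x‖ ^ q ∂μ ≤ ε ^ q := by
    calc ∫ x, ‖h x‖ ^ q ∂μ ≤ ∫ x, (s ^ q + 2 ^ q / s ^ 2 * ‖h x‖ ^ 2) ∂μ :=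
          integral_mono (hmem.integrable_norm_rpow hp0 hp')
            ((integrable_const _).add (hsqint.const_mul _)) hpt
      _ = m * s ^ q + 2 ^ q / s ^ 2 * ∫ x, ‖h x‖ ^ 2 ∂μ := by
          rw [integral_add (integrable_const _) (hsqint.const_mul _), integral_const,
            integral_const_mul, smul_eq_mul]
      _ ≤ m * s ^ q + 2 ^ q / s ^ 2 * (ε ^ q / 2 * (s ^ 2 / 2 ^ q)) := by gcongr
      _ = m * (ε ^ q / (2 * (m + 1))) + ε ^ q / 2 := by
          rw [hsq]
          congr 1
          field_simp
      _ ≤ ε ^ q := by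
          have : m * (ε ^ q / (2 * (m + 1))) ≤ ε ^ q / 2 := by
            rw [mul_div_assoc', div_le_div_iff₀ (by positivity) (by positivity)]
            nlinarith [Real.rpow_pos_of_pos hε q]
          linarith
  calc _ ≤ (ε ^ q) ^ q⁻¹ := Real.rpow_le_rpow (integral_nonneg fun x => by positivity) hI
        (by positivity)
    _ = ε := Real.rpow_rpow_inv hε.le hq0.ne'

lemma integral_norm_sum_sq_le {ι : Type*} (J : Finset ι) {r : ι → α → 𝕜}
    (hr : ∀ j, AEStronglyMeasurable (r j) μ) (hb : ∀ j x, ‖r j x‖ ≤ 2) {δ : ℝ} (hδ0 : 0 ≤ δ)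
    (hδ : ∀ i j, i ≠ j → ‖∫ x, r j x * (starRingEnd 𝕜) (r i x) ∂μ‖ ≤ δ) :
    ∫ x, ‖∑ j ∈ J, r j x‖ ^ 2 ∂μ ≤ J.card * (4 * μ.real Set.univ) + J.card ^ 2 * δ := by
  classical
  rcases J.eq_empty_or_nonempty with rfl | hJ
  · simp
  have hint : ∀ i j, Integrable (fun x => r j x * (starRingEnd 𝕜) (r i x)) μ := fun i j => by
    refine Integrable.of_bound ((hr j).mul (RCLike.continuous_conj.comp_aestronglyMeasurable
      (hr i))) 4 (ae_of_all _ fun x => ?_)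
    rw [norm_mul, RCLike.norm_conj]
    nlinarith [hb j x, hb i x, norm_nonneg (r j x), norm_nonneg (r i x)]
  have e : ∀ x, ‖∑ j ∈ J, r j x‖ ^ 2 =
      ∑ i ∈ J, ∑ j ∈ J, RCLike.re (r j x * (starRingEnd 𝕜) (r i x)) := by
    intro x
    have h : ‖∑ j ∈ J, r j x‖ ^ 2 =
        RCLike.re ((∑ j ∈ J, r j x) * (starRingEnd 𝕜) (∑ j ∈ J, r j x)) := by
      rw [RCLike.mul_conj, ← RCLike.ofReal_pow, RCLike.ofReal_re]
    rw [h, map_sum (starRingEnd 𝕜), Finset.mul_sum, map_sum]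
    refine Finset.sum_congr rfl fun i _ => ?_
    rw [Finset.sum_mul, map_sum]
  simp_rw [e]
  rw [integral_finsetSum _ fun i _ => integrable_finsetSum _ fun j _ => (hint i j).re]
  have h1 : ∀ i ∈ J, ∫ x, ∑ j ∈ J, RCLike.re (r j x * (starRingEnd 𝕜) (r i x)) ∂μ ≤
      4 * μ.real Set.univ + J.card * δ := by
    intro i hi
    rw [integral_finsetSum _ fun j _ => (hint i j).re, ← Finset.add_sum_erase _ _ hi]
    have hm : 0 ≤ μ.real Set.univ := measureReal_nonneg
    refine add_le_add ?_ ?_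
    · calc _ ≤ ∫ _, (4 : ℝ) ∂μ := by
            refine integral_mono (hint i i).re (integrable_const _) fun x => ?_
            refine (RCLike.re_le_norm _).trans ?_
            rw [norm_mul, RCLike.norm_conj]
            nlinarith [hb i x, norm_nonneg (r i x)]
        _ = _ := by rw [integral_const, smul_eq_mul, mul_comm]
    · calc _ ≤ ∑ j ∈ J.erase i, δ := by
            refine Finset.sum_le_sum fun j hj => ?_
            have h := integral_re (hint i j)
            rw [h]
            exact (RCLike.re_le_norm _).trans (hδ i j (Finset.ne_of_mem_erase hj).symm)
        _ = (J.erase i).card * δ := by rw [Finset.sum_const, nsmul_eq_mul]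
        _ ≤ _ := by
            gcongr
            exact Finset.erase_subset i J
  calc _ ≤ ∑ i ∈ J, (4 * μ.real Set.univ + J.card * δ) := Finset.sum_le_sum h1
    _ = _ := by rw [Finset.sum_const, nsmul_eq_mul]; ring

/-- Choosing almost orthogonal functions `g j - u` makes all partial averages of `g j - u`
small in `L^p`. -/
theorem exists_averages_of_almost_orthogonal {p : ℝ≥0∞} (hp0 : p ≠ 0) (hp' : p ≠ ⊤) {u : α → 𝕜}
    (hu : Measurable u) (hu1 : ∀ x, ‖u x‖ ≤ 1) (C : Set (α → 𝕜))
    (hC : ∀ g ∈ C, Measurable g ∧ ∀ x, ‖g x‖ ≤ 1)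
    (hsel : ∀ F : Finset (α → 𝕜), (∀ g ∈ F, g ∈ C) → ∀ δ : ℝ, 0 < δ →
      ∃ y ∈ C, ∀ g ∈ F, ‖∫ x, (y x - u x) * (starRingEnd 𝕜) (g x - u x) ∂μ‖ ≤ δ)
    {ε : ℝ} (hε : 0 < ε) :
    ∃ (N : ℕ) (g : Fin N → α → 𝕜), 0 < N ∧ (∀ j, g j ∈ C) ∧ ∀ J : Finset (Fin N),
      eLpNorm (fun x => ∑ j ∈ J, (N : 𝕜)⁻¹ * (g j x - u x)) p μ ≤ ENNReal.ofReal ε := by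
  obtain ⟨η, hη, hsmall⟩ := exists_eLpNorm_le_of_integral_sq_le (𝕜 := 𝕜) μ hp0 hp' hε
  -- The diagonal contributes at most 4 μ(univ) / N ≤ η/2 and the off-diagonal terms at most η/2,
  -- for every J.
  obtain ⟨N, hN⟩ := exists_nat_gt (8 * μ.real Set.univ / η)
  have hNpos : (0 : ℝ) < N := lt_of_le_of_lt (by positivity) hN
  -- Greedy choice: each function is tested only against its predecessors. The reverse order follows
  -- by conjugation.
  obtain ⟨f, hfC, hf⟩ := exists_seq_of_forall_finset_exists (fun g => g ∈ C)
    (fun g y : α → 𝕜 => ‖∫ x, (y x - u x) * (starRingEnd 𝕜) (g x - u x) ∂μ‖ ≤ η / 2)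
    (fun F hF => hsel F hF (η / 2) (by positivity))
  have hfb : ∀ j x, ‖f j x - u x‖ ≤ 2 := fun j x =>
    (norm_sub_le _ _).trans (by linarith [(hC _ (hfC j)).2 x, hu1 x])
  have hfm : ∀ j, AEStronglyMeasurable (fun x => f j x - u x) μ := fun j =>
    ((hC _ (hfC j)).1.sub hu).aestronglyMeasurable
  refine ⟨N, fun j => f j, by exact_mod_cast hNpos, fun j => hfC j, fun J => ?_⟩
  have hcard : (J.card : ℝ) ≤ N := by
    have := J.card_le_univ
    rw [Fintype.card_fin] at this
    exact_mod_cast this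
  apply hsmall
  · exact Finset.aestronglyMeasurable_fun_sum _ fun j _ => (hfm j).const_mul _
  · intro x
    refine (norm_sum_le _ _).trans ?_
    calc ∑ j ∈ J, ‖(N : 𝕜)⁻¹ * (f j x - u x)‖ ≤ ∑ j ∈ J, (N : ℝ)⁻¹ * 2 := by
          refine Finset.sum_le_sum fun j _ => ?_
          rw [norm_mul, norm_inv, RCLike.norm_natCast]
          gcongr
          exact hfb j x
      _ = J.card * ((N : ℝ)⁻¹ * 2) := by rw [Finset.sum_const, nsmul_eq_mul]
      _ ≤ N * ((N : ℝ)⁻¹ * 2) := by gcongr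
      _ = 2 := by field_simp
  · have h1 := integral_norm_sum_sq_le (μ := μ) J (r := fun (j : Fin N) x => f j x - u x)
      (fun j => hfm j) (fun j x => hfb j x) (δ := η / 2) (by positivity) (by
        intro i j hij
        rcases lt_or_gt_of_ne hij with h | h
        · exact hf i j h
        · have e : ∫ x, (f j x - u x) * (starRingEnd 𝕜) (f i x - u x) ∂μ =
              (starRingEnd 𝕜) (∫ x, (f i x - u x) * (starRingEnd 𝕜) (f j x - u x) ∂μ) := by
            refine Eq.trans ?_ integral_conj
            refine integral_congr_ae (ae_of_all _ fun x => ?_)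
            simp only [map_mul, RCLike.conj_conj, mul_comm]
          rw [e, RCLike.norm_conj]
          exact hf j i h)
    have e : ∀ x, ‖∑ j ∈ J, (N : 𝕜)⁻¹ * (f j x - u x)‖ ^ 2 =
        ((N : ℝ)⁻¹) ^ 2 * ‖∑ j ∈ J, (f j x - u x)‖ ^ 2 := by
      intro x
      rw [← Finset.mul_sum, norm_mul, norm_inv, RCLike.norm_natCast, mul_pow]
    simp_rw [e]
    rw [integral_const_mul]
    have hm : 0 ≤ μ.real Set.univ := measureReal_nonneg
    calc _ ≤ ((N : ℝ)⁻¹) ^ 2 * (J.card * (4 * μ.real Set.univ) + J.card ^ 2 * (η / 2)) := by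
          gcongr
      _ ≤ ((N : ℝ)⁻¹) ^ 2 * (N * (4 * μ.real Set.univ) + N ^ 2 * (η / 2)) := by gcongr
      _ = 4 * μ.real Set.univ / N + η / 2 := by field_simp
      _ ≤ η := by
          have : 4 * μ.real Set.univ / N ≤ η / 2 := by
            rw [div_lt_iff₀ hη] at hN
            rw [div_le_div_iff₀ hNpos (by norm_num)]
            linarith
          linarith

theorem exists_Lp_averages_of_almost_orthogonal {p : ℝ≥0∞} [Fact (1 ≤ p)] (hp' : p ≠ ⊤) {u : α → 𝕜}
    (hu : Measurable u) (hu1 : ∀ x, ‖u x‖ ≤ 1) (C : Set (α → 𝕜))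
    (hC : ∀ g ∈ C, Measurable g ∧ ∀ x, ‖g x‖ ≤ 1)
    (hsel : ∀ F : Finset (α → 𝕜), (∀ g ∈ F, g ∈ C) → ∀ δ : ℝ, 0 < δ →
      ∃ y ∈ C, ∀ g ∈ F, ‖∫ x, (y x - u x) * (starRingEnd 𝕜) (g x - u x) ∂μ‖ ≤ δ)
    {v : Lp 𝕜 p μ} (hv : v =ᵐ[μ] u) {ε : ℝ} (hε : 0 < ε) :
    ∃ (N : ℕ) (g : Fin N → Lp 𝕜 p μ), 0 < N ∧ (∀ j, ∃ φ ∈ C, g j =ᵐ[μ] φ) ∧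
      ∀ J : Finset (Fin N), ‖∑ j ∈ J, (N : 𝕜)⁻¹ • (g j - v)‖ ≤ ε := by
  have hp0 : p ≠ 0 := (zero_lt_one.trans_le Fact.out).ne'
  obtain ⟨N, g, hN, hgC, hg⟩ := exists_averages_of_almost_orthogonal (μ := μ) hp0 hp' hu hu1 C hC
    hsel hε
  have hmem : ∀ j, MemLp (g j) p μ := fun j =>
    MemLp.of_bound (hC _ (hgC j)).1.aestronglyMeasurable 1 (ae_of_all _ (hC _ (hgC j)).2)
  refine ⟨N, fun j => (hmem j).toLp, hN, fun j => ⟨g j, hgC j, (hmem j).coeFn_toLp⟩, fun J => ?_⟩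
  rw [Lp.norm_def]
  refine ENNReal.toReal_le_of_le_ofReal hε.le ?_
  refine (eLpNorm_congr_ae ?_).trans_le (hg J)
  have h1 : ∀ᵐ x ∂μ, ∀ j, ((N : 𝕜)⁻¹ • ((hmem j).toLp - v) : Lp 𝕜 p μ) x =
      (N : 𝕜)⁻¹ * (g j x - u x) := by
    rw [ae_all_iff]
    intro j
    filter_upwards [Lp.coeFn_smul (N : 𝕜)⁻¹ ((hmem j).toLp - v), Lp.coeFn_sub (hmem j).toLp v,
      (hmem j).coeFn_toLp, hv] with x h1 h2 h3 h4
    rw [h1, Pi.smul_apply, h2, Pi.sub_apply, h3, h4, smul_eq_mul]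
  filter_upwards [Lp.coeFn_fun_finsetSum J fun j => (N : 𝕜)⁻¹ • ((hmem j).toLp - v), h1]
    with x h2 h1
  rw [h2]
  exact Finset.sum_congr rfl fun j _ => h1 j

omit [IsFiniteMeasure μ] in
/-- The complexification of an unconditional frame of the real `L^p`. -/
theorem exists_complexified_frame {p : ℝ≥0∞} [Fact (1 ≤ p)] {ι : Type*} {u : ι → Lp ℝ p μ}
    {u' : ι → StrongDual ℝ (Lp ℝ p μ)} (hu : ∀ f, HasSum (fun i => u' i f • u i) f) :
    ∃ (v : ι → Lp ℂ p μ) (v' : ι → StrongDual ℂ (Lp ℂ p μ)),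
      (∀ i, v i =ᵐ[μ] fun x => (u i x : ℂ)) ∧ ∀ f, HasSum (fun i => v' i f • v i) f := by
  let J : Lp ℝ p μ →L[ℝ] Lp ℂ p μ := Complex.ofRealCLM.compLpL p μ
  let Re : Lp ℂ p μ →L[ℝ] Lp ℝ p μ := Complex.reCLM.compLpL p μ
  let Im : Lp ℂ p μ →L[ℝ] Lp ℝ p μ := Complex.imCLM.compLpL p μ
  have hJ : ∀ f : Lp ℝ p μ, J f =ᵐ[μ] fun x => (f x : ℂ) := fun f =>
    Complex.ofRealCLM.coeFn_compLpL f
  have hRe : ∀ f : Lp ℂ p μ, Re f =ᵐ[μ] fun x => (f x).re := fun f =>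
    Complex.reCLM.coeFn_compLpL f
  have hIm : ∀ f : Lp ℂ p μ, Im f =ᵐ[μ] fun x => (f x).im := fun f =>
    Complex.imCLM.coeFn_compLpL f
  have hReI : ∀ f, Re (Complex.I • f) = -Im f := by
    intro f
    apply Lp.ext
    filter_upwards [hRe (Complex.I • f), Lp.coeFn_neg (Im f), hIm f,
      Lp.coeFn_smul Complex.I f] with x h1 h2 h3 h4
    rw [h1, h2, Pi.neg_apply, h3, h4]
    simp
  have hdecomp : ∀ f, J (Re f) + Complex.I • J (Im f) = f := by
    intro f
    apply Lp.ext
    filter_upwards [Lp.coeFn_add (J (Re f)) (Complex.I • J (Im f)), hJ (Re f), hJ (Im f), hRe f,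
      hIm f, Lp.coeFn_smul Complex.I (J (Im f))] with x h1 h2 h3 h4 h5 h6
    rw [h1, Pi.add_apply, h2, h6, Pi.smul_apply, h3, h4, h5, smul_eq_mul, mul_comm]
    exact Complex.re_add_im _
  have hJs : ∀ (r : ℝ) f, J (r • f) = (r : ℂ) • J f := fun r f => by
    apply Lp.ext
    filter_upwards [hJ (r • f), Lp.coeFn_smul r f, Lp.coeFn_smul (r : ℂ) (J f), hJ f]
      with x h1 h2 h3 h4
    rw [h1, h2, h3, Pi.smul_apply, Pi.smul_apply, h4]
    simp
  -- Since Re(i f) = -Im f, the complex extension sends f to u'(Re f) + i u'(Im f).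
  refine ⟨fun i => J (u i), fun i => StrongDual.extendRCLike (𝕜 := ℂ) ((u' i).comp Re), fun i => hJ _, fun f => ?_⟩
  have h := ((hu (Re f)).mapL J).add (((hu (Im f)).mapL J).const_smul Complex.I)
  rw [hdecomp] at h
  convert h using 2 with i
  rw [hJs, hJs, smul_smul, ← add_smul]
  congr 1
  rw [StrongDual.extendRCLike_apply]
  simp [hReI]

lemma isSeminormalized_of_norm_eq_one {p : ℝ≥0∞} [Fact (1 ≤ p)]
    [NeZero μ] {g : ℕ → Lp 𝕜 p μ} (hg : ∀ n, ∀ᵐ x ∂μ, ‖g n x‖ = 1) : IsSeminormalized g := by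
  have hp0 : p ≠ 0 := (zero_lt_one.trans_le Fact.out).ne'
  have h : ∀ n, ‖g n‖ = (μ Set.univ ^ (1 / p.toReal)).toReal := fun n => by
    have e : eLpNorm (g n) p μ = eLpNorm (fun _ : α => (1 : ℝ)) p μ :=
      eLpNorm_congr_norm_ae (by filter_upwards [hg n] with x hx; simp [hx])
    rw [Lp.norm_def, e, eLpNorm_const _ hp0 (NeZero.ne μ)]
    simp
  have hpos : 0 < (μ Set.univ ^ (1 / p.toReal)).toReal := by
    have h0 : μ Set.univ ≠ 0 := by simpa using NeZero.ne μ
    refine ENNReal.toReal_pos (ENNReal.rpow_pos h0.bot_lt (measure_ne_top _ _)).ne' ?_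
    exact ENNReal.rpow_ne_top_of_nonneg (by positivity) (measure_ne_top _ _)
  exact ⟨_, _, hpos, hpos, fun n => ⟨(h n).ge, (h n).le⟩⟩

omit [IsFiniteMeasure μ] in
lemma isUniformlyBounded_of_norm_eq_one {p : ℝ≥0∞}
    {g : ℕ → Lp 𝕜 p μ} (hg : ∀ n, ∀ᵐ x ∂μ, ‖g n x‖ = 1) : IsUniformlyBounded g :=
  ⟨1, fun n => by filter_upwards [hg n] with x hx; exact hx.le⟩

end Averages

/-! ### Frames of sign functions. -/

section Signs

variable {α : Type*} [MeasurableSpace α] {μ : Measure α} [IsFiniteMeasure μ]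

/-- If some measurable function has null level sets, then every measurable set has measurable
subsets of any prescribed smaller measure. -/
lemma exists_measurable_subset_measureReal_eq {t : α → ℝ} (ht : Measurable t)
    (ht0 : ∀ c, μ {x | t x = c} = 0) {A : Set α} (hA : MeasurableSet A) {c : ℝ} (hc0 : 0 ≤ c)
    (hc : c ≤ μ.real A) : ∃ B ⊆ A, MeasurableSet B ∧ μ.real B = c := by
  rcases hc.eq_or_lt with rfl | hlt
  · exact ⟨A, le_rfl, hA, rfl⟩
  -- The law of t on A has no atoms, so the mass of (-s, s] is continuous in s and increases from 0
  -- towards μ(A); the intermediate value theorem applies. The limit need not be attained, hence the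
  -- separate case of equality.
  set ν := (μ.restrict A).map t with hν
  have : NullSingletonClass ν := ⟨fun x => by
    rw [hν, Measure.map_apply ht (measurableSet_singleton x)]
    exact measure_mono_null (fun y hy => hy) (nonpos_iff_eq_zero.1
      ((Measure.restrict_apply_le A _).trans (ht0 x).le))⟩
  have hI : ∀ a b, IntervalIntegrable (fun _ => (1 : ℝ)) ν a b := fun a b =>
    intervalIntegrable_const
  have hcont : Continuous fun s : ℝ => ∫ _ in (-s)..s, (1 : ℝ) ∂ν := by
    have h1 := intervalIntegral.continuous_primitive hI 0
    have h2 : (fun s : ℝ => ∫ _ in (-s)..s, (1 : ℝ) ∂ν) = fun s =>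
        (∫ _ in (0)..s, (1 : ℝ) ∂ν) - ∫ _ in (0)..(-s), (1 : ℝ) ∂ν := by
      funext s
      rw [intervalIntegral.integral_interval_sub_left (hI _ _) (hI _ _)]
    rw [h2]
    exact h1.sub (h1.comp continuous_neg)
  have hlim : Tendsto (fun s : ℝ => ∫ _ in (-s)..s, (1 : ℝ) ∂ν) atTop (𝓝 (μ.real A)) := by
    have h := intervalIntegral_tendsto_integral (μ := ν) (f := fun _ => (1 : ℝ))
      (integrable_const _) tendsto_neg_atTop_atBot tendsto_id
    have e : ∫ _, (1 : ℝ) ∂ν = μ.real A := by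
      rw [integral_const, hν, map_measureReal_apply ht MeasurableSet.univ]
      simp
    rwa [e] at h
  obtain ⟨s, hs⟩ := ((hlim.eventually (lt_mem_nhds hlt)).and (eventually_ge_atTop 0)).exists
  obtain ⟨r, hr, hr'⟩ := intermediate_value_Icc hs.2 hcont.continuousOn
    (show c ∈ Set.Icc _ _ from ⟨by simpa using hc0, hs.1.le⟩)
  refine ⟨t ⁻¹' Set.Ioc (-r) r ∩ A, Set.inter_subset_right, (ht measurableSet_Ioc).inter hA, ?_⟩
  rw [← hr']
  dsimp only
  rw [intervalIntegral.integral_of_le (by linarith [hr.1]), setIntegral_const, smul_eq_mul, mul_one,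
    hν, map_measureReal_apply ht measurableSet_Ioc, measureReal_restrict_apply
    (ht measurableSet_Ioc)]

/-- On each joint level set of u and the functions in `F`, put y = 1 on the proportion (1 + u)/2 of
the mass and y = -1 on the rest. Then y - u has integral zero there, while g - u is constant. -/
lemma exists_sign_function_orthogonal {t : α → ℝ} (ht : Measurable t)
    (ht0 : ∀ c, μ {x | t x = c} = 0) {u : α → ℝ} (hu : Measurable u)
    (huf : (Set.range u).Finite) (hu1 : ∀ x, |u x| ≤ 1) (F : Finset (α → ℝ))
    (hF : ∀ g ∈ F, Measurable g ∧ ∀ x, g x = 1 ∨ g x = -1) :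
    ∃ y : α → ℝ, (Measurable y ∧ ∀ x, y x = 1 ∨ y x = -1) ∧
      ∀ g ∈ F, ∫ x, (y x - u x) * (g x - u x) ∂μ = 0 := by
  classical
  let Φ : α → (F → ℝ) × ℝ := fun x => (fun g => g.1 x, u x)
  have hΦ : Measurable Φ :=
    (measurable_pi_lambda _ fun g => (hF g.1 g.2).1).prodMk hu
  have hR : (Set.range Φ).Finite := by
    refine Set.Finite.subset ((Set.Finite.pi (t := fun _ : F => ({1, -1} : Set ℝ))
      (fun _ => Set.toFinite _)).prod huf) ?_
    rintro _ ⟨x, rfl⟩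
    refine ⟨fun g _ => ?_, ⟨x, rfl⟩⟩
    simpa using (hF g.1 g.2).2 x
  have hA : ∀ b, MeasurableSet (Φ ⁻¹' {b}) := fun b => hΦ (measurableSet_singleton b)
  have hsub : ∀ b, ∃ B ⊆ Φ ⁻¹' {b}, MeasurableSet B ∧
      (|b.2| ≤ 1 → μ.real B = (1 + b.2) / 2 * μ.real (Φ ⁻¹' {b})) := by
    intro b
    by_cases hb : |b.2| ≤ 1
    · rw [abs_le] at hb
      obtain ⟨B, h1, h2, h3⟩ := exists_measurable_subset_measureReal_eq ht ht0 (hA b)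
        (c := (1 + b.2) / 2 * μ.real (Φ ⁻¹' {b}))
        (mul_nonneg (by linarith) measureReal_nonneg)
        (mul_le_of_le_one_left measureReal_nonneg (by linarith))
      exact ⟨B, h1, h2, fun _ => h3⟩
    · exact ⟨∅, Set.empty_subset _, MeasurableSet.empty, fun h => absurd h hb⟩
  choose B hBA hBm hBμ using hsub
  set E : Set α := ⋃ b ∈ hR.toFinset, B b with hE
  have hEm : MeasurableSet E := Finset.measurableSet_biUnion _ fun b _ => hBm b
  have hEB : ∀ b, E ∩ Φ ⁻¹' {b} = if b ∈ Set.range Φ then B b else ∅ := by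
    intro b
    ext x
    simp only [hE, Set.mem_inter_iff, Set.mem_iUnion, Set.Finite.mem_toFinset]
    constructor
    · rintro ⟨⟨b', hb', hx⟩, hxb⟩
      have h1 : Φ x = b' := hBA b' hx
      have h2 : Φ x = b := hxb
      rw [← h1.symm.trans h2, if_pos hb']
      exact hx
    · split_ifs with h
      · exact fun hx => ⟨⟨b, h, hx⟩, hBA b hx⟩
      · exact fun hx => absurd hx (Set.notMem_empty x)
  let y : α → ℝ := fun x => 2 * E.indicator (fun _ => (1 : ℝ)) x - 1
  have hym : Measurable y := ((measurable_const.indicator hEm).const_mul 2).sub_const 1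
  have hy : ∀ x, y x = 1 ∨ y x = -1 := by
    intro x
    by_cases hx : x ∈ E
    · left; simp [y, hx]; norm_num
    · right; simp [y, hx]
  refine ⟨y, ⟨hym, hy⟩, fun g hg => ?_⟩
  have hybd : ∀ x, |y x| ≤ 1 := fun x => by rcases hy x with h | h <;> simp [h]
  have hgbd : ∀ x, |g x| ≤ 1 := fun x => by rcases (hF g hg).2 x with h | h <;> simp [h]
  have hint : Integrable (fun x => (y x - u x) * (g x - u x)) μ := by
    refine Integrable.of_bound (((hym.sub hu).mul ((hF g hg).1.sub hu)).aestronglyMeasurable) 4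
      (ae_of_all _ fun x => ?_)
    rw [norm_mul]
    have h1 : ‖y x - u x‖ ≤ 2 := (norm_sub_le _ _).trans (by
      simp only [Real.norm_eq_abs]; linarith [hybd x, hu1 x])
    have h2 : ‖g x - u x‖ ≤ 2 := (norm_sub_le _ _).trans (by
      simp only [Real.norm_eq_abs]; linarith [hgbd x, hu1 x])
    nlinarith [norm_nonneg (y x - u x), norm_nonneg (g x - u x)]
  have hcover : ⋃ b ∈ hR.toFinset, Φ ⁻¹' {b} = Set.univ := by
    ext x
    simp
  rw [← setIntegral_univ, ← hcover, integral_biUnion_finset _ (fun b _ => hA b) ?_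
    (fun b _ => hint.integrableOn)]
  · refine Finset.sum_eq_zero fun b hb => ?_
    have hbR : b ∈ Set.range Φ := by simpa using hb
    have hb1 : |b.2| ≤ 1 := by
      obtain ⟨x, rfl⟩ := hbR
      exact hu1 x
    have e : ∫ x in Φ ⁻¹' {b}, (y x - u x) * (g x - u x) ∂μ =
        ∫ x in Φ ⁻¹' {b}, (y x - b.2) * (b.1 ⟨g, hg⟩ - b.2) ∂μ := by
      refine setIntegral_congr_fun (hA b) fun x hx => ?_
      have hx : Φ x = b := hx
      rw [← hx]
    have hyi : Integrable y μ :=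
      Integrable.of_bound hym.aestronglyMeasurable 1 (ae_of_all _ hybd)
    have hind : ∫ x in Φ ⁻¹' {b}, y x ∂μ = b.2 * μ.real (Φ ⁻¹' {b}) := by
      have hi : Integrable (E.indicator fun _ => (1 : ℝ)) μ :=
        (integrable_const (1 : ℝ)).indicator hEm
      rw [integral_sub (hi.integrableOn.const_mul 2) (integrable_const _), integral_const_mul,
        integral_indicator hEm, Measure.restrict_restrict hEm, hEB, if_pos hbR, setIntegral_const,
        setIntegral_const, hBμ b hb1]
      simp
      ring
    rw [e, integral_mul_const, integral_sub hyi.integrableOn (integrable_const _), hind,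
      setIntegral_const, smul_eq_mul]
    ring
  · intro b _ b' _ hbb'
    exact Disjoint.preimage _ (Set.disjoint_singleton.2 hbb')

/-- On a separable finite measure space carrying a measurable function with null level sets,
the real space `L^p` has an unconditional frame of sign functions. -/
theorem exists_sign_frame {p : ℝ≥0∞} [Fact (1 ≤ p)] (hp : 1 < p) (hp' : p < ⊤) [IsSeparable μ]
    {t : α → ℝ} (ht : Measurable t) (ht0 : ∀ c, μ {x | t x = c} = 0) :
    ∃ (g : ℕ → Lp ℝ p μ) (g' : ℕ → StrongDual ℝ (Lp ℝ p μ)),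
      (∀ f, HasSum (fun n => g' n f • g n) f) ∧ ∀ n, ∀ᵐ x ∂μ, g n x = 1 ∨ g n x = -1 := by
  obtain ⟨h, u, u', hh, huh, hu⟩ := exists_haar_frame (μ := μ) hp hp'
  obtain ⟨g, g', hg, hgG⟩ := exists_frame_mem_of_averages hu
    {f : Lp ℝ p μ | ∀ᵐ x ∂μ, f x = 1 ∨ f x = -1} (fun i ε hε => by
      obtain ⟨N, g, hN, hgC, hg⟩ := exists_Lp_averages_of_almost_orthogonal hp'.ne (hh i).1
        (hh i).2.2 {y : α → ℝ | Measurable y ∧ ∀ x, y x = 1 ∨ y x = -1}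
        (fun y hy => ⟨hy.1, fun x => by rcases hy.2 x with h | h <;> simp [h]⟩)
        (fun F hF δ hδ => by
          obtain ⟨y, hy, hyF⟩ := exists_sign_function_orthogonal ht ht0 (hh i).1 (hh i).2.1
            (hh i).2.2 F hF
          exact ⟨y, hy, fun g hg => by
            simp only [conj_trivial, hyF g hg, norm_zero]; exact hδ.le⟩)
        (huh i) hε
      refine ⟨N, g, hN, fun j => ?_, hg⟩
      obtain ⟨φ, hφ, hgφ⟩ := hgC j
      filter_upwards [hgφ] with x hx
      rw [hx]
      exact hφ.2 x)
  exact ⟨g, g', hg, hgG⟩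

end Signs

/-! ### Smooth unimodular frames; the one-point space. -/

section Smooth

variable {d : ℕ}

/-- The character of frequency `k • w`. -/
noncomputable def planeWave (w : EuclideanSpace ℝ (Fin d)) (k : ℕ)
    (x : EuclideanSpace ℝ (Fin d)) : ℂ :=
  Real.fourierChar (-inner ℝ x ((k : ℝ) • w))

lemma norm_planeWave (w : EuclideanSpace ℝ (Fin d)) (k : ℕ) (x : EuclideanSpace ℝ (Fin d)) :
    ‖planeWave w k x‖ = 1 := Circle.norm_coe _

lemma planeWave_pow (w : EuclideanSpace ℝ (Fin d)) (k m : ℕ) (x : EuclideanSpace ℝ (Fin d)) :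
    planeWave w k x ^ m = planeWave w (m * k) x := by
  rw [planeWave, planeWave, ← Circle.coe_pow, ← AddChar.map_nsmul_eq_pow]
  congr 2
  rw [inner_smul_right, inner_smul_right, nsmul_eq_mul]
  push_cast
  ring

lemma contDiff_planeWave (w : EuclideanSpace ℝ (Fin d)) (k : ℕ) :
    ContDiff ℝ ∞ (planeWave w k) := by
  have : planeWave w k = fun x => Complex.exp
      (((2 * Real.pi * -inner ℝ x ((k : ℝ) • w) : ℝ) : ℂ) * Complex.I) := by
    funext x
    rw [planeWave, Real.fourierChar_apply]
  rw [this]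
  refine ContDiff.cexp (ContDiff.mul ?_ contDiff_const)
  refine Complex.ofRealCLM.contDiff.comp ?_
  exact contDiff_const.mul (contDiff_id.inner ℝ contDiff_const).neg

/-- Riemann–Lebesgue for φ cut off to Ω: the frequencies k • w leave every compact set because w ≠
0. -/
lemma tendsto_integral_planeWave_mul {Ω : Set (EuclideanSpace ℝ (Fin d))}
    (hΩ : NullMeasurableSet Ω volume) {w : EuclideanSpace ℝ (Fin d)} (hw : w ≠ 0)
    (φ : EuclideanSpace ℝ (Fin d) → ℂ) :
    Tendsto (fun k => ∫ x in Ω, planeWave w k x * φ x) atTop (𝓝 0) := by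
  have h := tendsto_integral_exp_inner_smul_cocompact (Ω.indicator φ)
  have hk : Tendsto (fun k : ℕ => (k : ℝ) • w) atTop (cocompact (EuclideanSpace ℝ (Fin d))) := by
    rw [← Metric.cobounded_eq_cocompact, ← tendsto_norm_atTop_iff_cobounded]
    simp_rw [norm_smul, RCLike.norm_natCast]
    exact tendsto_natCast_atTop_atTop.atTop_mul_const (norm_pos_iff.2 hw)
  refine (h.comp hk).congr fun k => ?_
  rw [← integral_indicator₀ hΩ]
  refine integral_congr_ae (ae_of_all _ fun x => ?_)
  dsimp only
  by_cases hx : x ∈ Ω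
  · rw [Set.indicator_of_mem hx, Set.indicator_of_mem hx]
    rfl
  · rw [Set.indicator_of_notMem hx, Set.indicator_of_notMem hx, smul_zero]

/-- A unimodular function whose weak limit is `u`, as the oscillation `z` gets faster. -/
noncomputable def blaschke (u : ℝ) (z : ℂ) : ℂ := (z + u) / (1 + u * z)

lemma one_add_mul_ne_zero {u : ℝ} (hu : |u| ≤ 1 / 2) {z : ℂ} (hz : ‖z‖ = 1) :
    1 + (u : ℂ) * z ≠ 0 := by
  intro h
  have h1 : (u : ℂ) * z = -1 := by linear_combination h
  have h2 := congrArg norm h1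
  rw [norm_mul, hz, mul_one, Complex.norm_real, Real.norm_eq_abs, norm_neg, norm_one] at h2
  linarith

lemma norm_blaschke {u : ℝ} (hu : |u| ≤ 1 / 2) {z : ℂ} (hz : ‖z‖ = 1) : ‖blaschke u z‖ = 1 := by
  have h1 : z * (starRingEnd ℂ) z = 1 := by
    rw [Complex.mul_conj, Complex.normSq_eq_norm_sq, hz]; simp
  have h2 : z + u = z * (starRingEnd ℂ) (1 + u * z) := by
    rw [map_add, map_one, map_mul, Complex.conj_ofReal]
    linear_combination (-(u : ℂ)) * h1
  rw [blaschke, h2, norm_div, norm_mul, hz, one_mul, Complex.norm_conj,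
    div_self (norm_ne_zero_iff.2 (one_add_mul_ne_zero hu hz))]

/-- The difference is (1 - u²) z / (1 + u z), a geometric series with positive powers of z only, so
every term oscillates. -/
lemma hasSum_blaschke_sub {u : ℝ} (hu : |u| ≤ 1 / 2) {z : ℂ} (hz : ‖z‖ = 1) :
    HasSum (fun m : ℕ => (1 - (u : ℂ) ^ 2) * (-u) ^ m * z ^ (m + 1)) (blaschke u z - u) := by
  have hlt : ‖-(u : ℂ) * z‖ < 1 := by
    rw [norm_mul, hz, mul_one, norm_neg, Complex.norm_real, Real.norm_eq_abs]
    linarith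
  have h := (hasSum_geometric_of_norm_lt_one hlt).mul_left ((1 - (u : ℂ) ^ 2) * z)
  have e1 : (fun m : ℕ => (1 - (u : ℂ) ^ 2) * (-u) ^ m * z ^ (m + 1)) =
      fun m : ℕ => (1 - (u : ℂ) ^ 2) * z * (-(u : ℂ) * z) ^ m := by
    funext m
    rw [mul_pow]
    ring
  have e2 : blaschke u z - u = (1 - (u : ℂ) ^ 2) * z * (1 - -(u : ℂ) * z)⁻¹ := by
    have h0 := one_add_mul_ne_zero hu hz
    rw [blaschke, show 1 - -(u : ℂ) * z = 1 + u * z by ring, eq_mul_inv_iff_mul_eq₀ h0, sub_mul,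
      div_mul_cancel₀ _ h0]
    ring
  rw [e1, e2]
  exact h

/-- The m-th term is a plane wave of frequency (m + 1)k against a fixed function, so
Riemann–Lebesgue applies to each. Since |u| ≤ 1/2, the terms are dominated by (1/2)^m ∫ ‖φ‖
uniformly in k, and the limit passes through the sum. -/
lemma tendsto_integral_blaschke_sub_mul {Ω : Set (EuclideanSpace ℝ (Fin d))}
    (hΩ : NullMeasurableSet Ω volume) {w : EuclideanSpace ℝ (Fin d)} (hw : w ≠ 0)
    {u : EuclideanSpace ℝ (Fin d) → ℝ} (hu : Continuous u) (hu1 : ∀ x, |u x| ≤ 1 / 2)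
    {φ : EuclideanSpace ℝ (Fin d) → ℂ} (hφ : IntegrableOn φ Ω) :
    Tendsto (fun k => ∫ x in Ω, (blaschke (u x) (planeWave w k x) - u x) * φ x) atTop (𝓝 0) := by
  set F : ℕ → ℕ → EuclideanSpace ℝ (Fin d) → ℂ := fun k m x =>
    planeWave w ((m + 1) * k) x * ((1 - (u x : ℂ) ^ 2) * (-u x) ^ m * φ x) with hF
  have hcoef : ∀ m x, ‖(1 - (u x : ℂ) ^ 2) * (-u x) ^ m‖ ≤ (1 / 2) ^ m := by
    intro m x
    have h1 : ‖1 - (u x : ℂ) ^ 2‖ ≤ 1 := by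
      have : (1 - (u x : ℂ) ^ 2) = ((1 - (u x) ^ 2 : ℝ) : ℂ) := by push_cast; ring
      rw [this, Complex.norm_real, Real.norm_eq_abs, abs_le]
      have := hu1 x
      rw [abs_le] at this
      constructor <;> nlinarith
    rw [norm_mul, norm_pow, norm_neg, Complex.norm_real, Real.norm_eq_abs]
    calc _ ≤ 1 * (1 / 2) ^ m := mul_le_mul h1 (pow_le_pow_left₀ (abs_nonneg _) (hu1 x) m)
          (by positivity) zero_le_one
      _ = _ := one_mul _
  have hFn : ∀ k m x, ‖F k m x‖ ≤ (1 / 2) ^ m * ‖φ x‖ := by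
    intro k m x
    rw [hF]
    dsimp only
    rw [norm_mul, norm_planeWave, one_mul, norm_mul]
    exact mul_le_mul_of_nonneg_right (hcoef m x) (norm_nonneg _)
  have hFi : ∀ k m, Integrable (F k m) (volume.restrict Ω) := by
    intro k m
    have hc : Continuous fun x => planeWave w ((m + 1) * k) x * ((1 - (u x : ℂ) ^ 2) *
        (-u x) ^ m) := by
      have := (contDiff_planeWave w ((m + 1) * k)).continuous
      fun_prop
    refine Integrable.mono' (hφ.norm.const_mul ((1 / 2) ^ m)) ?_ (ae_of_all _ (hFn k m))
    have := hc.aestronglyMeasurable.mul hφ.1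
    refine this.congr (ae_of_all _ fun x => ?_)
    simp [hF, mul_assoc]
  have hbound : ∀ k m, ∫ x in Ω, ‖F k m x‖ ≤ (1 / 2) ^ m * ∫ x in Ω, ‖φ x‖ := by
    intro k m
    rw [← integral_const_mul]
    exact integral_mono (hFi k m).norm (hφ.norm.const_mul _) (hFn k m)
  have hgeo : Summable fun m : ℕ => (1 / 2 : ℝ) ^ m * ∫ x in Ω, ‖φ x‖ :=
    (summable_geometric_of_lt_one (by norm_num) (by norm_num)).mul_right _
  have hsum : ∀ k, ∑' m, ∫ x in Ω, F k m x =
      ∫ x in Ω, (blaschke (u x) (planeWave w k x) - u x) * φ x := by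
    intro k
    have h := hasSum_integral_of_summable_integral_norm (hFi k)
      (Summable.of_nonneg_of_le (fun m => integral_nonneg fun x => norm_nonneg _) (hbound k) hgeo)
    rw [h.tsum_eq]
    refine integral_congr_ae (ae_of_all _ fun x => ?_)
    dsimp only
    have h2 := (hasSum_blaschke_sub (hu1 x) (norm_planeWave w k x)).mul_right (φ x)
    rw [← h2.tsum_eq]
    congr 1
    funext m
    rw [hF, planeWave_pow]
    ring
  have hlim := tendsto_tsum_of_dominated_convergence (f := fun k m => ∫ x in Ω, F k m x)
    (g := fun _ => (0 : ℂ)) (𝓕 := atTop) hgeo (fun m => by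
      have h := tendsto_integral_planeWave_mul hΩ hw
        (fun x => (1 - (u x : ℂ) ^ 2) * (-u x) ^ m * φ x)
      exact h.comp (tendsto_atTop_mono (fun k => Nat.le_mul_of_pos_left k m.succ_pos) tendsto_id))
    (Eventually.of_forall fun k m => (norm_integral_le_integral_norm _).trans (hbound k m))
  rw [tsum_zero] at hlim
  exact hlim.congr hsum

/-- Smooth L^p approximation need not respect the bound on h. Approximating arcsin h and taking the
sine does, and costs nothing because sine is 1-Lipschitz. -/
lemma exists_smooth_approx {μ : Measure (EuclideanSpace ℝ (Fin d))} [IsFiniteMeasure μ]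
    {p : ℝ≥0∞} [Fact (1 ≤ p)] (hp' : p ≠ ⊤) {h : EuclideanSpace ℝ (Fin d) → ℝ} (hh : Measurable h)
    (hh1 : ∀ x, |h x| ≤ 1) {ε : ℝ} (hε : 0 < ε) :
    ∃ u : EuclideanSpace ℝ (Fin d) → ℝ, ContDiff ℝ ∞ u ∧ (∀ x, |u x| ≤ 1 / 2) ∧
      eLpNorm (fun x => u x - h x / 2) p μ ≤ ENNReal.ofReal ε := by
  have hm : Measurable fun x => Real.arcsin (h x) := Real.measurable_arcsin.comp hh
  have hmem : MemLp (fun x => Real.arcsin (h x)) p μ :=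
    MemLp.of_bound hm.aestronglyMeasurable (Real.pi / 2) (ae_of_all _ fun x => by
      rw [Real.norm_eq_abs, abs_le]
      exact ⟨Real.neg_pi_div_two_le_arcsin _, Real.arcsin_le_pi_div_two _⟩)
  obtain ⟨g, -, hg, hgε⟩ := hmem.exist_eLpNorm_sub_le hp' Fact.out hε
  refine ⟨fun x => Real.sin (g x) / 2, (Real.contDiff_sin.comp hg).div_const 2, fun x => ?_, ?_⟩
  · rw [abs_div, abs_two]
    linarith [Real.abs_sin_le_one (g x)]
  · refine (eLpNorm_mono fun x => ?_).trans hgε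
    rw [Pi.sub_apply, Real.norm_eq_abs, Real.norm_eq_abs, ← sub_div, abs_div, abs_two]
    have h1 := Real.abs_sin_sub_sin_le (Real.arcsin (h x)) (g x)
    have := abs_le.1 (hh1 x)
    rw [Real.sin_arcsin this.1 this.2, abs_sub_comm] at h1
    linarith [abs_nonneg (Real.arcsin (h x) - g x)]

theorem exists_smooth_averages {Ω : Set (EuclideanSpace ℝ (Fin d))}
    (hΩ : NullMeasurableSet Ω volume) [IsFiniteMeasure (volume.restrict Ω)]
    {w : EuclideanSpace ℝ (Fin d)} (hw : w ≠ 0) {p : ℝ≥0∞} [Fact (1 ≤ p)] (hp' : p ≠ ⊤)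
    {h : EuclideanSpace ℝ (Fin d) → ℝ} (hh : Measurable h) (hh1 : ∀ x, |h x| ≤ 1)
    {v : Lp ℂ p (volume.restrict Ω)} (hv : v =ᵐ[volume.restrict Ω] fun x => (h x : ℂ))
    {ε : ℝ} (hε : 0 < ε) :
    ∃ (N : ℕ) (g : Fin N → Lp ℂ p (volume.restrict Ω)), 0 < N ∧
      (∀ j, ∃ φ : EuclideanSpace ℝ (Fin d) → ℂ, ContDiff ℝ ∞ φ ∧ (∀ x, ‖φ x‖ = 1) ∧
        ∀ᵐ x ∂(volume.restrict Ω), g j x = φ x) ∧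
      ∀ J : Finset (Fin N), ‖∑ j ∈ J, (N : ℂ)⁻¹ • (g j - (2 : ℂ)⁻¹ • v)‖ ≤ ε := by
  obtain ⟨u, hu, hu1, huh⟩ := exists_smooth_approx (μ := volume.restrict Ω) (p := p) hp' hh hh1
    (half_pos hε)
  have huc : Continuous fun x => (u x : ℂ) := Complex.continuous_ofReal.comp hu.continuous
  have hub : ∀ x, ‖(u x : ℂ)‖ ≤ 1 := fun x => by
    rw [Complex.norm_real, Real.norm_eq_abs]; linarith [hu1 x]
  have hmem : MemLp (fun x => (u x : ℂ)) p (volume.restrict Ω) :=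
    MemLp.of_bound huc.aestronglyMeasurable 1 (ae_of_all _ hub)
  set V := hmem.toLp with hV
  have hVv : ‖V - (2 : ℂ)⁻¹ • v‖ ≤ ε / 2 := by
    rw [Lp.norm_def]
    refine ENNReal.toReal_le_of_le_ofReal (by positivity) (le_trans (le_of_eq ?_) huh)
    refine eLpNorm_congr_norm_ae ?_
    filter_upwards [Lp.coeFn_sub V ((2 : ℂ)⁻¹ • v), hmem.coeFn_toLp, Lp.coeFn_smul (2 : ℂ)⁻¹ v, hv]
      with x h1 h2 h3 h4
    rw [h1, Pi.sub_apply, h2, h3, Pi.smul_apply, h4, ← Complex.norm_real]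
    congr 1
    push_cast
    rw [smul_eq_mul]
    ring
  let C : Set (EuclideanSpace ℝ (Fin d) → ℂ) := {φ | ContDiff ℝ ∞ φ ∧ ∀ x, ‖φ x‖ = 1}
  obtain ⟨N, g, hN, hgC, hg⟩ := exists_Lp_averages_of_almost_orthogonal (μ := volume.restrict Ω)
    hp' huc.measurable hub C (fun φ hφ => ⟨hφ.1.continuous.measurable, fun x => (hφ.2 x).le⟩)
    (fun F hF δ hδ => by
      have hev : ∀ᶠ k in atTop, ∀ φ ∈ F, ‖∫ x in Ω, (blaschke (u x) (planeWave w k x) - u x) *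
          (starRingEnd ℂ) (φ x - u x)‖ ≤ δ := by
        rw [eventually_all_finset]
        intro φ hφ
        have hφC := hF φ hφ
        have hc : Continuous fun x => (starRingEnd ℂ) (φ x - u x) :=
          Complex.continuous_conj.comp (hφC.1.continuous.sub huc)
        have hint : IntegrableOn (fun x => (starRingEnd ℂ) (φ x - u x)) Ω :=
          Integrable.of_bound hc.aestronglyMeasurable 2 (ae_of_all _ fun x => by
            rw [RCLike.norm_conj]
            exact (norm_sub_le _ _).trans (by linarith [hub x, hφC.2 x]))
        have := (tendsto_integral_blaschke_sub_mul hΩ hw hu.continuous hu1 hint).norm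
        rw [norm_zero] at this
        exact (this.eventually (gt_mem_nhds hδ)).mono fun k hk => hk.le
      obtain ⟨k, hk⟩ := hev.exists
      refine ⟨fun x => blaschke (u x) (planeWave w k x), ⟨?_, fun x =>
        norm_blaschke (hu1 x) (norm_planeWave w k x)⟩, hk⟩
      have hus : ContDiff ℝ ∞ fun x => (u x : ℂ) := Complex.ofRealCLM.contDiff.comp hu
      simp_rw [blaschke, div_eq_mul_inv]
      exact ((contDiff_planeWave w k).add hus).mul (ContDiff.inv
        (contDiff_const.add (hus.mul (contDiff_planeWave w k)))
        fun x => one_add_mul_ne_zero (hu1 x) (norm_planeWave w k x)))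
    hmem.coeFn_toLp (half_pos hε)
  refine ⟨N, g, hN, fun j => ?_, fun J => ?_⟩
  · obtain ⟨φ, hφ, h⟩ := hgC j
    exact ⟨φ, hφ.1, hφ.2, h⟩
  -- Passing from the smooth V back to v/2 costs a fraction |J|/N ≤ 1 of ‖V - v/2‖, hence at most
  -- ε/2.
  · have e : ∑ j ∈ J, (N : ℂ)⁻¹ • (g j - (2 : ℂ)⁻¹ • v) =
        ∑ j ∈ J, (N : ℂ)⁻¹ • (g j - V) + ((J.card : ℂ) * (N : ℂ)⁻¹) • (V - (2 : ℂ)⁻¹ • v) := by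
      rw [mul_smul, Nat.cast_smul_eq_nsmul, ← Finset.sum_const, ← Finset.sum_add_distrib]
      refine Finset.sum_congr rfl fun j _ => ?_
      rw [← smul_add, sub_add_sub_cancel]
    have hc : ‖(J.card : ℂ) * (N : ℂ)⁻¹‖ ≤ 1 := by
      rw [norm_mul, norm_inv, RCLike.norm_natCast, RCLike.norm_natCast, ← div_eq_mul_inv]
      refine div_le_one_of_le₀ ?_ (by positivity)
      have := J.card_le_univ
      rw [Fintype.card_fin] at this
      exact_mod_cast this
    rw [e]
    refine (norm_add_le _ _).trans ?_
    rw [norm_smul]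
    have := mul_le_of_le_one_left (norm_nonneg (V - (2 : ℂ)⁻¹ • v)) hc
    linarith [hg J]

theorem exists_smooth_unimodular_frame {Ω : Set (EuclideanSpace ℝ (Fin d))}
    (hΩ : NullMeasurableSet Ω volume) [IsFiniteMeasure (volume.restrict Ω)]
    {w : EuclideanSpace ℝ (Fin d)} (hw : w ≠ 0) {p : ℝ≥0∞} [Fact (1 ≤ p)] (hp : 1 < p)
    (hp' : p < ⊤) :
    ∃ (g : ℕ → Lp ℂ p (volume.restrict Ω)) (g' : ℕ → StrongDual ℂ (Lp ℂ p (volume.restrict Ω))),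
      (∀ f, HasSum (fun n => g' n f • g n) f) ∧
      ∀ n, ∃ φ : EuclideanSpace ℝ (Fin d) → ℂ, ContDiff ℝ ∞ φ ∧ (∀ x, ‖φ x‖ = 1) ∧
        ∀ᵐ x ∂(volume.restrict Ω), g n x = φ x := by
  obtain ⟨h, u, u', hh, huh, hu⟩ := exists_haar_frame (μ := volume.restrict Ω) hp hp'
  obtain ⟨v, v', hvu, hv⟩ := exists_complexified_frame hu
  -- Halving the vectors and doubling the functionals keeps the frame and makes room for |u| ≤ 1/2,
  -- which keeps 1 + u z away from 0.
  have hv2 : ∀ f, HasSum (fun i => ((2 : ℂ) • v' i) f • ((2 : ℂ)⁻¹ • v i)) f := fun f => by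
    convert hv f using 2 with i
    rw [smul_apply, smul_smul, smul_eq_mul]
    congr 1
    ring
  refine exists_frame_mem_of_averages hv2 {f : Lp ℂ p (volume.restrict Ω) |
    ∃ φ : EuclideanSpace ℝ (Fin d) → ℂ, ContDiff ℝ ∞ φ ∧ (∀ x, ‖φ x‖ = 1) ∧
        ∀ᵐ x ∂(volume.restrict Ω), f x = φ x} fun i ε hε => ?_
  refine exists_smooth_averages hΩ hw hp'.ne (hh i).1 (hh i).2.2 ?_ hε
  filter_upwards [hvu i, huh i] with x h1 h2
  rw [h1, h2]

lemma volume_restrict_coordinate_eq_zero (Ω : Set (EuclideanSpace ℝ (Fin d))) (i : Fin d) (c : ℝ) :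
    volume.restrict Ω {x : EuclideanSpace ℝ (Fin d) | x i = c} = 0 := by
  have h : volume {x : EuclideanSpace ℝ (Fin d) | x i = c} = 0 := by
    have h1 := Measure.pi_hyperplane (fun _ : Fin d => (volume : Measure ℝ)) i c
    have h2 := (PiLp.volume_preserving_ofLp (Fin d)).measure_preimage
      (s := {f : Fin d → ℝ | f i = c})
      ((measurableSet_singleton c).preimage (measurable_pi_apply i)).nullMeasurableSet
    exact h2.trans h1
  exact nonpos_iff_eq_zero.1 ((Measure.restrict_apply_le _ _).trans h.le)

/-- Over a one-point space, the constant function `1` alone is a frame. -/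
lemma exists_constant_frame {α : Type*} [MeasurableSpace α] [Subsingleton α] {μ : Measure α}
    [IsFiniteMeasure μ] [NeZero μ] {p : ℝ≥0∞} [Fact (1 ≤ p)] :
    ∃ (g : ℕ → Lp ℝ p μ) (g' : ℕ → StrongDual ℝ (Lp ℝ p μ)),
      (∀ f, HasSum (fun n => g' n f • g n) f) ∧ ∀ n, ∀ᵐ x ∂μ, g n x = 1 := by
  have hmem : MemLp (fun _ : α => (1 : ℝ)) p μ := memLp_const 1
  -- L^p is spanned by the constant 1; the vector is repeated and all functionals but the zeroth
  -- vanish.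
  refine ⟨fun _ => hmem.toLp, fun n => if n = 0 then averageFunctional μ p Set.univ else 0,
    fun f => ?_, fun n => hmem.coeFn_toLp⟩
  have h : averageFunctional μ p Set.univ f • hmem.toLp = f := by
    apply Lp.ext
    filter_upwards [Lp.coeFn_smul (averageFunctional μ p Set.univ f) hmem.toLp, hmem.coeFn_toLp]
      with x h1 h2
    rw [h1, Pi.smul_apply, h2, averageFunctional_apply, Measure.restrict_univ,
      show (f : α → ℝ) = fun _ => f x from funext fun y => by rw [Subsingleton.elim y x],
      average_const, smul_eq_mul, mul_one]
  have h2 := hasSum_ite_eq (0 : ℕ) (averageFunctional μ p Set.univ f • hmem.toLp)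
  convert h2 using 2 with n
  · by_cases hn : n = 0
    · dsimp only
      rw [if_pos hn, if_pos hn]
    · dsimp only
      rw [if_neg hn, if_neg hn, zero_apply, zero_smul]
  · exact h.symm

end Smooth

/-! ### The theorem. -/

theorem theorem1p1 (d : ℕ) (Ω : Set (EuclideanSpace ℝ (Fin d)))
    (hΩ : NullMeasurableSet Ω volume) (hpos : 0 < volume Ω) (hfin : volume Ω < ⊤)
    (p : ℝ≥0∞) [Fact (1 ≤ p)] (hp : 1 < p) (hp' : p < ⊤) :
    (∃ (g : ℕ → Lp ℝ p (volume.restrict Ω))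
        (g' : ℕ → StrongDual ℝ (Lp ℝ p (volume.restrict Ω))),
      IsUnconditionalSchauderFrame ℝ g g' ∧
      (∀ n, ∀ᵐ x ∂(volume.restrict Ω), g n x = 1 ∨ g n x = -1) ∧
      IsSeminormalized g ∧ IsUniformlyBounded g) ∧
    (∃ (g : ℕ → Lp ℂ p (volume.restrict Ω))
        (g' : ℕ → StrongDual ℂ (Lp ℂ p (volume.restrict Ω))),
      IsUnconditionalSchauderFrame ℂ g g' ∧
      (∀ n, ∀ᵐ x ∂(volume.restrict Ω), g n x = 1 ∨ g n x = -1) ∧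
      IsSeminormalized g ∧ IsUniformlyBounded g) ∧
    (∃ (g : ℕ → Lp ℂ p (volume.restrict Ω))
        (g' : ℕ → StrongDual ℂ (Lp ℂ p (volume.restrict Ω))),
      IsUnconditionalSchauderFrame ℂ g g' ∧
      (∀ n, ∃ φ : EuclideanSpace ℝ (Fin d) → ℂ, ContDiff ℝ ∞ φ ∧ (∀ x, ‖φ x‖ = 1) ∧
        ∀ᵐ x ∂(volume.restrict Ω), g n x = φ x) ∧
      IsSeminormalized g ∧ IsUniformlyBounded g) := by
  have hfinite : IsFiniteMeasure (volume.restrict Ω) := ⟨by simpa using hfin⟩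
  have hne : NeZero (volume.restrict Ω) := ⟨by
    rw [Ne, Measure.restrict_eq_zero]
    exact hpos.ne'⟩
  obtain ⟨g, g', hg, hgs⟩ : ∃ (g : ℕ → Lp ℝ p (volume.restrict Ω))
      (g' : ℕ → StrongDual ℝ (Lp ℝ p (volume.restrict Ω))),
      (∀ f, HasSum (fun n => g' n f • g n) f) ∧
      ∀ n, ∀ᵐ x ∂(volume.restrict Ω), g n x = 1 ∨ g n x = -1 := by
    -- In dimension 0 the space is a point: there is no coordinate with null level sets, and below
    -- no nonzero frequency.
    cases d with
    | zero =>
      obtain ⟨g, g', hg, h1⟩ := exists_constant_frame (μ := volume.restrict Ω) (p := p)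
      exact ⟨g, g', hg, fun n => (h1 n).mono fun x hx => Or.inl hx⟩
    | succ d =>
      exact exists_sign_frame hp hp' (t := fun x => x 0) (by fun_prop)
        (volume_restrict_coordinate_eq_zero Ω 0)
  obtain ⟨v, v', hvg, hv⟩ := exists_complexified_frame hg
  have hvs : ∀ n, ∀ᵐ x ∂(volume.restrict Ω), v n x = 1 ∨ v n x = -1 := fun n => by
    filter_upwards [hvg n, hgs n] with x h1 h2
    rw [h1]
    rcases h2 with h2 | h2 <;> simp [h2]
  obtain ⟨e, e', he, hes⟩ : ∃ (g : ℕ → Lp ℂ p (volume.restrict Ω))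
      (g' : ℕ → StrongDual ℂ (Lp ℂ p (volume.restrict Ω))),
      (∀ f, HasSum (fun n => g' n f • g n) f) ∧
      ∀ n, ∃ φ : EuclideanSpace ℝ (Fin d) → ℂ, ContDiff ℝ ∞ φ ∧ (∀ x, ‖φ x‖ = 1) ∧
        ∀ᵐ x ∂(volume.restrict Ω), g n x = φ x := by
    cases d with
    | zero =>
      obtain ⟨g, g', hg, h1⟩ := exists_constant_frame (μ := volume.restrict Ω) (p := p)
      obtain ⟨v, v', hvg, hv⟩ := exists_complexified_frame hg
      refine ⟨v, v', hv, fun n => ⟨fun _ => 1, contDiff_const, fun x => norm_one, ?_⟩⟩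
      filter_upwards [hvg n, h1 n] with x h1 h2
      rw [h1, h2, Complex.ofReal_one]
    | succ d =>
      exact exists_smooth_unimodular_frame hΩ (w := EuclideanSpace.single 0 1)
        (by simp) hp hp'
  have n1 : ∀ n, ∀ᵐ x ∂(volume.restrict Ω), ‖g n x‖ = 1 := fun n =>
    (hgs n).mono fun x hx => by rcases hx with h | h <;> simp [h]
  have n2 : ∀ n, ∀ᵐ x ∂(volume.restrict Ω), ‖v n x‖ = 1 := fun n =>
    (hvs n).mono fun x hx => by rcases hx with h | h <;> simp [h]
  have n3 : ∀ n, ∀ᵐ x ∂(volume.restrict Ω), ‖e n x‖ = 1 := fun n => by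
    obtain ⟨φ, -, hφ, h⟩ := hes n
    exact h.mono fun x hx => by rw [hx, hφ]
  exact ⟨⟨g, g', isUnconditionalSchauderFrame_of_hasSum hg, hgs,
      isSeminormalized_of_norm_eq_one n1, isUniformlyBounded_of_norm_eq_one n1⟩,
    ⟨v, v', isUnconditionalSchauderFrame_of_hasSum hv, hvs,
      isSeminormalized_of_norm_eq_one n2, isUniformlyBounded_of_norm_eq_one n2⟩,
    ⟨e, e', isUnconditionalSchauderFrame_of_hasSum he, hes,
      isSeminormalized_of_norm_eq_one n3, isUniformlyBounded_of_norm_eq_one n3⟩⟩
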